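/- **Setting.** Let $S,A$ be measurable spaces, $T,k\in\mathbb N$, and let $r_\theta(s,a)$, $\theta\in\mathbb R^k$, be a parametrized reward that is jointly measurable in $(\theta,s,a)$. A trajectory is $\xi=(s_0,a_0,\dots,a_{T-1},s_T)$, with $J_\theta(\xi)=\sum_{t<T}r_\theta(s_t,a_t)$; an instance is a pair $x=(\xi^0,\xi^1)$, drawn from an unknown probability distribution $P$. Let $\Theta_0\subseteq\mathbb R^k$ be measurable and $\theta_H\in\Theta_0$ (the human reward). The true label $y^{\rm true}(x)$ is $1$ if $J_{\theta_H}(\xi^0)\le J_{\theta_H}(\xi^1)$ and $0$ otherwise. Put $f(\theta,\xi^0,\xi^1,y)=(1-2y)\,(J_\theta(\xi^0)-J_\theta(\xi^1))$ and $\mathrm{err}(r_\theta)=P\big(f(\theta,\xi^0,\xi^1,y^{\rm true})<0\big)$. Let $h_\theta(x)=1$ if $J_\theta(\xi^0)<J_\theta(\xi^1)$ and $h_\theta(x)=0$ otherwise, $\mathcal H=\{h_\theta:\theta\in\Theta_0\}$ and $h^*=h_{\theta_H}$. For a set $\mathcal V$ of classifiers let $\mathrm{DIS}(\mathcal V)=\{x:\exists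 h_1,h_2\in\mathcal V,\ h_1(x)\ne h_2(x)\}$. Let $d$ be the VC dimension of $\mathcal H$ and $$\zeta=\sup_{\rho>0}\frac{P\big(\mathrm{DIS}(\{h\in\mathcal H: P(h\neq h^*)\le\rho\})\big)}{\rho}$$ the disagreement coefficient. Assume $d<\infty$ and $\zeta<\infty$. Assume also that every $\theta\in\Theta_0$ has the same ties as the human up to null sets: for $P$-almost every $x$, $J_\theta(\xi^0)=J_\theta(\xi^1)$ if and only if $J_{\theta_H}(\xi^0)=J_{\theta_H}(\xi^1)$ (for example, ties have probability zero). **Algorithm (HSBC).** For $i=0,\dots,I-1$: given the earlier batches, draw $N$ independent pairs $(\xi^0_{i,j},\xi^1_{i,j})$ from $P(\,\cdot\mid\mathrm{DIS}(\mathcal V_i))$, where $\mathcal V_i=\{h_\theta:\theta\in\Theta_i\}$ (if $P(\mathrm{DIS}(\mathcal V_i))=0$, the batch may be arbitrary), obtain labels $y_{i,j}$, and set $\Theta_{i+1}=\Theta_i\cap\{\theta: f(\theta,\xi^0_{i,j},\xi^1_{i,j},y_{i,j})\ge0,\ j=1,\dots,N\}$. **Theorem.** There is a universal constant $C>0$ such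 that for all $\zeta\in[0,\infty)$, $d\in\mathbb N$, $\epsilon>0$ and $\delta\in(0,1)$ there are a batch size $N$ and a number of batches $I$, depending only on $(\zeta,d,\epsilon,\delta)$, with $$K=NI\le C\,\bar\zeta\Big(d\log\bar\zeta+\log\frac{L}{\delta}\Big)L,\qquad \bar\zeta=\max(\zeta,2),\quad L=\max\big(\log\tfrac1\epsilon,1\big),$$ and the following holds for every problem as above with disagreement coefficient $\zeta$ and VC dimension $d$: if all labels are true, i.e. $y_{i,j}=y^{\rm true}(\xi^0_{i,j},\xi^1_{i,j})$, then after $I$ batches of size $N$, with probability at least $1-\delta$, every $\theta\in\Theta_I$ satisfies $\mathrm{err}(r_\theta)\le\epsilon$. In particular, for $\zeta\ge2$ and $\epsilon\le1/e$, $$K=O\Big(\zeta\big(d\log\zeta+\log(\log(1/\epsilon)/\delta)\big)\log(1/\epsilon)\Big).$$ -/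

import Mathlib

open MeasureTheory ProbabilityTheory
open scoped ENNReal NNReal

namespace HSBC

noncomputable section

/-- A trajectory `(s₀, a₀, …, a_{T-1}, s_T)`: its `T + 1` states and its `T` actions. -/
abbrev Trajectory (S : Type*) (A : Type*) (T : ℕ) : Type _ := (Fin (T + 1) → S) × (Fin T → A)

/-- An instance `x = (ξ⁰, ξ¹)`: a pair of trajectories. -/
abbrev TrajPair (S : Type*) (A : Type*) (T : ℕ) : Type _ := Trajectory S A T × Trajectory S A T

/-- A labelled preference `((ξ⁰, ξ¹), y)`. -/
abbrev Preference (S : Type*) (A : Type*) (T : ℕ) : Type _ := TrajPair S A T × Fin 2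

/-- The parameter space `ℝ^k` of the reward model. -/
abbrev Param (k : ℕ) : Type := EuclideanSpace ℝ (Fin k)

section Reward

variable {S A : Type*} {T k : ℕ}

/-- The cumulated reward `J_θ(ξ) = ∑_{t < T} r_θ(s_t, a_t)`. -/
def cumReward (r : Param k → S → A → ℝ) (θ : Param k) (ξ : Trajectory S A T) : ℝ :=
  ∑ t : Fin T, r θ (ξ.1 t.castSucc) (ξ.2 t)

/-- The true human label: `1` if `J_{θ_H}(ξ⁰) ≤ J_{θ_H}(ξ¹)` and `0` otherwise. -/
def trueLabel (r : Param k → S → A → ℝ) (θH : Param k) (x : TrajPair S A T) : Fin 2 :=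
  open Classical in if cumReward r θH x.1 ≤ cumReward r θH x.2 then 1 else 0

/-- `f(θ, ξ⁰, ξ¹, y) = (1 - 2 y) (J_θ(ξ⁰) - J_θ(ξ¹))`. -/
def prefFun (r : Param k → S → A → ℝ) (θ : Param k) (p : Preference S A T) : ℝ :=
  (1 - 2 * ((p.2 : ℕ) : ℝ)) * (cumReward r θ p.1.1 - cumReward r θ p.1.2)

/-- The batch cut `{θ | f(θ, ξ⁰_j, ξ¹_j, y_j) ≥ 0 for every j}`. -/
def batchCut {N : ℕ} (r : Param k → S → A → ℝ) (B : Fin N → Preference S A T) :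
    Set (Param k) :=
  {θ | ∀ j, 0 ≤ prefFun r θ (B j)}

/-- The hypothesis spaces `Θ_{i+1} = Θ_i ∩ C_i`, started at `Θ₀`, where `C_i` is the cut made by
the batch `B i`. -/
def hypSpace {N : ℕ} (r : Param k → S → A → ℝ) (Θ₀ : Set (Param k))
    (B : ℕ → Fin N → Preference S A T) : ℕ → Set (Param k)
  | 0 => Θ₀
  | i + 1 => hypSpace r Θ₀ B i ∩ batchCut r (B i)

/-- The classifier induced by `r_θ`: `0` if `J_θ(ξ⁰) ≥ J_θ(ξ¹)`, and `1` if
`J_θ(ξ⁰) < J_θ(ξ¹)`. -/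
def classifier (r : Param k → S → A → ℝ) (θ : Param k) (x : TrajPair S A T) : Fin 2 :=
  open Classical in if cumReward r θ x.1 < cumReward r θ x.2 then 1 else 0

/-- The classifiers `{h_θ | θ ∈ Θ'}` induced by a set `Θ'` of parameters. For `Θ' = Θ₀` this is
the concept class, for `Θ' = Θ_i` the version space. -/
def classifiers (T : ℕ) (r : Param k → S → A → ℝ) (Θ' : Set (Param k)) :
    Set (TrajPair S A T → Fin 2) :=
  classifier r '' Θ'

/-- The preference prediction error `err(r_θ) = P(f(θ, ξ⁰, ξ¹, y^true) < 0)`, where `(ξ⁰, ξ¹)`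
has law `P`. -/
def predError [MeasurableSpace S] [MeasurableSpace A] (r : Param k → S → A → ℝ) (θH : Param k)
    (P : Measure (TrajPair S A T)) (θ : Param k) : ℝ≥0∞ :=
  P {x | prefFun r θ (x, trueLabel r θH x) < 0}

end Reward

section Classifiers

variable {X : Type*}

/-- A finite set is shattered by `H` if `H` realizes every labelling of it. -/
def Shatters (H : Set (X → Fin 2)) (s : Finset X) : Prop :=
  ∀ b : X → Fin 2, ∃ h ∈ H, ∀ x ∈ s, h x = b x

/-- The Vapnik–Chervonenkis dimension: the supremum of the sizes of the shattered finite sets. -/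
def vcDim (H : Set (X → Fin 2)) : ℕ∞ :=
  ⨆ (s : Finset X) (_ : Shatters H s), (s.card : ℕ∞)

/-- The region of disagreement of a set of classifiers. -/
def disRegion (V : Set (X → Fin 2)) : Set X :=
  {x | ∃ h₁ ∈ V, ∃ h₂ ∈ V, h₁ x ≠ h₂ x}

/-- The ball `{h ∈ H | P(h_c ≠ h) ≤ ρ}`. -/
def classBall [MeasurableSpace X] (P : Measure X) (H : Set (X → Fin 2)) (hc : X → Fin 2)
    (ρ : ℝ) : Set (X → Fin 2) :=
  {h | h ∈ H ∧ P {x | hc x ≠ h x} ≤ ENNReal.ofReal ρ}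

/-- The disagreement coefficient `sup_{ρ > 0} P(DIS(B(h*, ρ))) / ρ`. -/
def disCoeff [MeasurableSpace X] (P : Measure X) (H : Set (X → Fin 2)) (hstar : X → Fin 2) :
    ℝ≥0∞ :=
  ⨆ (ρ : ℝ) (_ : 0 < ρ), P (disRegion (classBall P H hstar ρ)) / ENNReal.ofReal ρ

end Classifiers

/-- Disagreement-based batch queries. `B i` is the `i`-th batch, of `N` labelled preferences, on
the probability space `(Ω, μ)`. For each of the `I` batches, given the earlier batches, the `N`
pairs of the batch are independent with law `P` conditioned on the region of disagreement of the
current version space. If that region is `P`-null there is no such law, and nothing is required of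
the batch. -/
structure IsDisagreementQuery {S A Ω : Type*} [MeasurableSpace S] [MeasurableSpace A]
    [MeasurableSpace Ω] {T k N : ℕ} (r : Param k → S → A → ℝ) (Θ₀ : Set (Param k))
    (P : Measure (TrajPair S A T)) (I : ℕ) (μ : Measure Ω)
    (B : ℕ → Ω → Fin N → Preference S A T) : Prop where
  measurable : ∀ i, Measurable (B i)
  condLaw : ∀ i < I, ∀ E : Set (Fin N → TrajPair S A T), MeasurableSet E →
    ∀ᵐ ω ∂μ,
      P (disRegion (classifiers T r (hypSpace r Θ₀ (fun n => B n ω) i))) ≠ 0 →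
      (μ⟦{ω' | (fun j => (B i ω' j).1) ∈ E} |
          MeasurableSpace.comap (fun ω' (n : Fin i) => B n ω') inferInstance⟧) ω =
        (Measure.pi fun _ : Fin N =>
          P[|disRegion (classifiers T r (hypSpace r Θ₀ (fun n => B n ω) i))]).real E

end

end HSBC

/-!
Write `E_θ = {x | f(θ, x, y^true) < 0}` for the error set of a parameter, and `p_i` for the
`P`-measure of the region of disagreement `D_i` of the version space after `i` batches. The human
parameter survives every batch of true labels. Hence a surviving `θ` disagrees with the human
classifier only on `D_i`, and by the hypothesis on ties `P (E_θ) = P (E_θ ∩ D_i) ≤ p_i`. It is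
enough to show that a batch halves `p_i` outside an event of probability `δ / I`: then
`I ≥ log₂ (1 / ε)` batches suffice.

Suppose that every `θ` which survives the batch has `P (E_θ | D_i) ≤ η` with
`η = 1 / (2 max (ζ, 2))`. Then the surviving classifiers lie in the ball of radius `η p_i` around
the human one, and by the definition of the disagreement coefficient `p_{i+1} ≤ ζ η p_i ≤ p_i / 2`
(`measure_disRegion_le_half`).

That a batch of `N` pairs has this property with high probability is the `ε`-net theorem
(`measure_missEvent_le`), proved by double sampling: if the sample misses a set of measure larger
than `η`, then a second independent sample hits it at least `η N / 2` times with probability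
`1 / 2` or more; when the members of the pairs of the double sample are exchanged at random, a
given trace of the class has probability at most `2 ^ (-η N / 2)` of having no point in the first
half and `η N / 2` or more in the second, and the Sauer–Shelah lemma bounds the number of traces.
The bound on that number is used in the form `t ^ (-d) exp (2 t N)` with `t = η / 16`, which avoids
a factor `log N`.
The class to which the theorem is applied is that of the error sets, whose dimension is at most
that of the classifiers because `E_θ` is the pull-back of `{h_θ = 1}` along the map that exchanges
the members of a pair if the human weakly prefers the second (`vcBounded_errSet`).

Two points concern measurability. The events above are projections, along the parameter space, of
measurable sets; they need not be measurable, but they are null-measurable for every finite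
measure, since analytic sets are universally measurable
(`nullMeasurableSet_exists_of_measurableSet`). The sampling hypothesis prescribes the conditional
probability of each fixed event, whereas the event of a failed batch depends on the history through
`D_i`; null-measurability of the graph of `D_i` makes the conditional law a kernel, which determines
the joint law of the history and the batch (`measure_missEvent_cond_le`).
-/

namespace HSBC

/-! ### Measurable projections -/

open Set Filter Topology in
/-- The continuous image of Baire space contains compact sets of almost full measure. The compact
set is the image of a box `{x | ∀ k, x k ≤ g k}`, whose bounds are chosen one coordinate at a time
so that the measure of the image stays above `c`. -/
theorem exists_isCompact_subset_range_of_lt {W : Type*} [TopologicalSpace W] [PolishSpace W]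
    [MeasurableSpace W] [BorelSpace W] (μ : Measure W) [IsFiniteMeasure μ]
    {f : (ℕ → ℕ) → W} (hf : Continuous f) {c : ℝ≥0∞} (hc : c < μ (range f)) :
    ∃ K ⊆ range f, IsCompact K ∧ c ≤ μ K := by
  have step : ∀ (k : ℕ) (s : Set (ℕ → ℕ)), ∃ n : ℕ,
      c < μ (f '' s) → c < μ (f '' (s ∩ {x | x k ≤ n})) := by
    intro k s
    by_cases h : c < μ (f '' s)
    · have hU : f '' s = ⋃ n : ℕ, f '' (s ∩ {x | x k ≤ n}) := by
        rw [← image_iUnion, ← inter_iUnion]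
        congr 1
        refine (inter_eq_left.2 fun x _ => mem_iUnion.2 ⟨x k, ?_⟩).symm
        exact le_refl (x k)
      have hm : Monotone fun n : ℕ => f '' (s ∩ {x | x k ≤ n}) := by
        intro a b hab
        exact image_mono (inter_subset_inter_right _ fun x (hx : x k ≤ a) => hx.trans hab)
      rw [hU, hm.measure_iUnion, lt_iSup_iff] at h
      exact ⟨h.choose, fun _ => h.choose_spec⟩
    · exact ⟨0, fun h' => absurd h' h⟩
  choose F hF using step
  let S : ℕ → Set (ℕ → ℕ) := fun k => Nat.rec univ (fun k s => s ∩ {x | x k ≤ F k s}) k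
  have hS : ∀ k, c < μ (f '' S k) := by
    intro k
    induction k with
    | zero => simpa [S] using hc
    | succ k ih => exact hF k (S k) ih
  let g : ℕ → ℕ := fun k => F k (S k)
  have hSmem : ∀ k x, x ∈ S k ↔ ∀ i < k, x i ≤ g i := by
    intro k x
    induction k with
    | zero => simp [S]
    | succ k ih =>
      have : x ∈ S (k + 1) ↔ x ∈ S k ∧ x k ≤ g k := Iff.rfl
      rw [this, ih]
      constructor
      · rintro ⟨h1, h2⟩ i hi
        rcases Nat.lt_succ_iff_lt_or_eq.1 hi with h | rfl
        · exact h1 i h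
        · exact h2
      · exact fun h => ⟨fun i hi => h i (by omega), h k (by omega)⟩
  let K : Set (ℕ → ℕ) := univ.pi fun k => Iic (g k)
  have hK : IsCompact K := isCompact_univ_pi fun k => (finite_Iic (g k)).isCompact
  refine ⟨f '' K, image_subset_range f K, hK.image hf, ?_⟩
  let := TopologicalSpace.upgradeIsCompletelyMetrizable W
  rw [(f '' K).measure_eq_iInf_isOpen]
  refine le_iInf₂ fun U hU => le_iInf fun hUo => ?_
  -- An open neighbourhood of `K` contains one of the sets `S k`, although these are not compact:
  -- points of `S k` outside it can be truncated into `K` without changing their first `k` entries.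
  suffices h : ∃ k, S k ⊆ f ⁻¹' U by
    obtain ⟨k, hk⟩ := h
    exact (hS k).le.trans (measure_mono (image_subset_iff.2 hk))
  by_contra! hcon
  have hcon' : ∀ k, ∃ x, x ∈ S k ∧ x ∉ f ⁻¹' U := fun k => not_subset.1 (hcon k)
  choose x hxS hxU using hcon'
  have hy : ∀ k, (fun i => min (x k i) (g i)) ∈ K := fun k i _ =>
    show min (x k i) (g i) ≤ g i from min_le_right _ _
  obtain ⟨y, hyK, φ, hφ, hlim⟩ := hK.tendsto_subseq hy
  have hlim' : Tendsto (fun n => x (φ n)) atTop (𝓝 y) := by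
    rw [tendsto_pi_nhds] at hlim ⊢
    intro i
    refine (hlim i).congr' ?_
    filter_upwards [eventually_gt_atTop i] with n hn
    exact min_eq_left ((hSmem _ _).1 (hxS (φ n)) i (hn.trans_le hφ.le_apply))
  have hcl : IsClosed (f ⁻¹' U)ᶜ := (hUo.preimage hf).isClosed_compl
  exact hcl.mem_of_tendsto hlim' (Eventually.of_forall fun n => hxU (φ n)) (hU ⟨y, hyK, rfl⟩)

/-- Analytic sets are universally measurable. -/
theorem nullMeasurableSet_of_analyticSet {W : Type*} [TopologicalSpace W] [PolishSpace W]
    [MeasurableSpace W] [BorelSpace W] (μ : Measure W) [IsFiniteMeasure μ] {s : Set W}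
    (hs : AnalyticSet s) : NullMeasurableSet s μ := by
  rw [AnalyticSet] at hs
  rcases hs with rfl | ⟨f, hf, rfl⟩
  · exact MeasurableSet.empty.nullMeasurableSet
  by_cases h0 : μ (Set.range f) = 0
  · exact NullMeasurableSet.of_null h0
  obtain ⟨u, -, hu, hlim⟩ := exists_seq_strictMono_tendsto' (pos_iff_ne_zero.2 h0)
  choose K hKs hKc hKm using fun n => exists_isCompact_subset_range_of_lt μ hf (hu n).2
  let := TopologicalSpace.upgradeIsCompletelyMetrizable W
  have hm : MeasurableSet (⋃ n, K n) := MeasurableSet.iUnion fun n => (hKc n).measurableSet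
  have hle : μ (Set.range f) ≤ μ (⋃ n, K n) :=
    le_of_tendsto' hlim fun n => (hKm n).trans (measure_mono (Set.subset_iUnion K n))
  exact hm.nullMeasurableSet.congr
    (ae_eq_of_subset_of_measure_ge (Set.iUnion_subset hKs) hle hm.nullMeasurableSet
      (measure_ne_top _ _))

/-- A measurable set of a product depends on its second coordinate only through a measurable map
into a standard Borel space, since it belongs to the `σ`-algebra generated by countably many
rectangles. -/
theorem exists_standardBorel_factorization {Z Y : Type*} [MeasurableSpace Z] [MeasurableSpace Y]
    {E : Set (Z × Y)} (hE : MeasurableSet E) :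
    ∃ (W : Type) (_ : MeasurableSpace W) (_ : StandardBorelSpace W) (φ : Y → W) (_ : Measurable φ)
      (E' : Set (Z × W)), MeasurableSet E' ∧ E = Prod.map id φ ⁻¹' E' := by
  induction E, hE using MeasurableSpace.induction_on_inter generateFrom_prod.symm
    isPiSystem_prod with
  | empty =>
    exact ⟨Unit, inferInstance, inferInstance, fun _ => (), measurable_const, ∅, .empty, rfl⟩
  | basic t ht =>
    obtain ⟨B, hB, F, hF, rfl⟩ := ht
    refine ⟨Prop, inferInstance, inferInstance, fun y => y ∈ F, measurable_mem.2 hF,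
      B ×ˢ {p | p}, MeasurableSet.prod hB (MeasurableSet.of_discrete), ?_⟩
    ext ⟨z, y⟩
    simp
  | compl t ht ih =>
    obtain ⟨W, _, _, φ, hφ, E', hE', rfl⟩ := ih
    exact ⟨W, inferInstance, inferInstance, φ, hφ, E'ᶜ, hE'.compl, rfl⟩
  | iUnion t _ _ ih =>
    choose W mW sW φ hφ E' hE' heq using ih
    refine ⟨∀ n, W n, inferInstance, inferInstance, fun y n => φ n y, measurable_pi_lambda _ hφ,
      ⋃ n, (fun p => (p.1, p.2 n)) ⁻¹' E' n, MeasurableSet.iUnion fun n => ?_, ?_⟩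
    · exact (measurable_fst.prodMk ((measurable_pi_apply n).comp measurable_snd)) (hE' n)
    · ext ⟨z, y⟩
      simp [heq]

/-- Measurable projection: the projection along a standard Borel space of a measurable set of a
product is null-measurable, for an arbitrary measurable space as base. -/
theorem nullMeasurableSet_exists_of_measurableSet {Z Y : Type*} [MeasurableSpace Z]
    [StandardBorelSpace Z] [MeasurableSpace Y] (ν : Measure Y) [IsFiniteMeasure ν]
    {E : Set (Z × Y)} (hE : MeasurableSet E) : NullMeasurableSet {y | ∃ z, (z, y) ∈ E} ν := by
  obtain ⟨W, _, _, φ, hφ, E', hE', rfl⟩ := exists_standardBorel_factorization hE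
  let := upgradeStandardBorel W
  have hA : AnalyticSet (Prod.snd '' E') := hE'.analyticSet_image measurable_snd
  have := (nullMeasurableSet_of_analyticSet (ν.map φ) hA).preimage
    (Measure.QuasiMeasurePreserving.mk hφ Measure.AbsolutelyContinuous.rfl)
  convert this using 1
  ext y
  simp

/-! ### Sauer–Shelah and splittings of a double sample -/

section Combinatorics

open Finset

/-- A class of sets, indexed by `Θ₀`, whose shattered finite sets have at most `d` elements. -/
def VCBounded {X Z : Type*} (Θ₀ : Set Z) (A : Z → Set X) (d : ℕ) : Prop :=
  ∀ s : Finset X, (∀ t ⊆ s, ∃ θ ∈ Θ₀, ∀ x ∈ s, x ∈ A θ ↔ x ∈ t) → #s ≤ d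

open Classical in
/-- The traces left by a class of sets on a finite family of points `q`, as sets of indices. -/
noncomputable def traces {X Z κ : Type*} [Fintype κ] (Θ₀ : Set Z) (A : Z → Set X) (q : κ → X) :
    Finset (Finset κ) :=
  {a | ∃ θ ∈ Θ₀, ∀ k, k ∈ a ↔ q k ∈ A θ}

theorem vcDim_traces_le {X Z κ : Type*} [Fintype κ] [DecidableEq κ] {Θ₀ : Set Z} {A : Z → Set X}
    {d : ℕ} (h : VCBounded Θ₀ A d) (q : κ → X) : (traces Θ₀ A q).vcDim ≤ d := by
  classical
  refine Finset.sup_le fun s hs => ?_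
  rw [mem_shatterer] at hs
  have hinj : Set.InjOn q s := by
    intro k hk k' hk' hq
    by_contra hne
    obtain ⟨a, ha, hsa⟩ := hs (singleton_subset_iff.2 hk)
    obtain ⟨θ, -, hθ⟩ := (mem_filter.1 ha).2
    have h1 : k ∈ a := (mem_inter.1 (hsa ▸ mem_singleton_self k)).2
    have h2 : k' ∈ a := (hθ k').2 (hq ▸ (hθ k).1 h1)
    exact hne (mem_singleton.1 (hsa ▸ mem_inter.2 ⟨hk', h2⟩)).symm
  rw [← card_image_of_injOn hinj]
  refine h _ fun t _ => ?_
  obtain ⟨a, ha, hsa⟩ := hs (filter_subset (fun k => q k ∈ t) s)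
  obtain ⟨θ, hθ0, hθ⟩ := (mem_filter.1 ha).2
  refine ⟨θ, hθ0, fun x hx => ?_⟩
  obtain ⟨k, hk, rfl⟩ := mem_image.1 hx
  rw [← hθ k]
  have := congrArg (k ∈ ·) hsa
  simpa [hk] using this

/-- The Sauer–Shelah lemma in exponential form. -/
theorem card_mul_pow_le_exp {κ : Type*} [Fintype κ] [DecidableEq κ] {𝒜 : Finset (Finset κ)} {d : ℕ}
    (h : 𝒜.vcDim ≤ d) {t : ℝ} (ht0 : 0 ≤ t) (ht1 : t ≤ 1) :
    (#𝒜 : ℝ) * t ^ d ≤ Real.exp (t * Fintype.card κ) := by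
  set n := Fintype.card κ
  have h1 : (#𝒜 : ℝ) ≤ ∑ k ∈ Iic d, (n.choose k : ℝ) := by
    have := (𝒜.card_le_card_shatterer.trans card_shatterer_le_sum_vcDim).trans
      (sum_le_sum_of_subset (Iic_subset_Iic.2 h))
    exact_mod_cast this
  calc (#𝒜 : ℝ) * t ^ d ≤ (∑ k ∈ Iic d, (n.choose k : ℝ)) * t ^ d := by gcongr
    _ = ∑ k ∈ Iic d, (n.choose k : ℝ) * t ^ d := sum_mul _ _ _
    _ ≤ ∑ k ∈ Iic d, (n.choose k : ℝ) * t ^ k := by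
        refine sum_le_sum fun k hk => mul_le_mul_of_nonneg_left ?_ (Nat.cast_nonneg _)
        exact pow_le_pow_of_le_one ht0 ht1 (mem_Iic.1 hk)
    _ ≤ ∑ k ∈ range (n + 1), (n.choose k : ℝ) * t ^ k := by
        rw [← sum_filter_add_sum_filter_not (Iic d) (· < n + 1)]
        have hz : ∑ k ∈ Iic d with ¬ k < n + 1, (n.choose k : ℝ) * t ^ k = 0 := by
          refine sum_eq_zero fun k hk => ?_
          rw [Nat.choose_eq_zero_of_lt (by have := (mem_filter.1 hk).2; omega)]
          simp
        rw [hz, add_zero]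
        refine sum_le_sum_of_subset_of_nonneg (fun k hk => ?_) fun k _ _ => by positivity
        exact mem_range.2 (mem_filter.1 hk).2
    _ = (t + 1) ^ n := by
        rw [add_pow]
        exact sum_congr rfl fun k _ => by ring
    _ ≤ Real.exp t ^ n := by gcongr; exact Real.add_one_le_exp t
    _ = Real.exp (t * n) := by rw [← Real.exp_nat_mul]; ring_nf

/-- Of the `2 ^ n` ways to split `n` pairs into a first and a second half, a proportion of at most
`2 ^ (-m)` puts no element of `a` into the first half and `m` or more into the second: any two such
splittings agree on the pairs that meet `a`. -/
theorem card_splittings_mul_two_pow_le {ι : Type*} [Fintype ι] [DecidableEq ι]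
    (a : Finset (ι × Bool)) (m : ℕ) :
    #{σ : ι → Bool | (∀ j, (j, σ j) ∉ a) ∧ m ≤ #{j | (j, !σ j) ∈ a}} * 2 ^ m
      ≤ 2 ^ Fintype.card ι := by
  classical
  set G : Finset (ι → Bool) := {σ | (∀ j, (j, σ j) ∉ a) ∧ m ≤ #{j | (j, !σ j) ∈ a}} with hG
  rcases G.eq_empty_or_nonempty with h | ⟨σ₀, hσ₀⟩
  · simp [h]
  obtain ⟨-, hm⟩ := (mem_filter.1 hσ₀).2
  set J : Finset ι := {j | (j, !σ₀ j) ∈ a} with hJ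
  have hagree : ∀ σ ∈ G, ∀ j ∈ J, σ j = σ₀ j := by
    intro σ hσ j hj
    by_contra hne
    refine ((mem_filter.1 hσ).2).1 j ?_
    rw [Bool.eq_not.2 hne]
    exact (mem_filter.1 hj).2
  have hinj : Set.InjOn (fun (σ : ι → Bool) (j : {j // j ∉ J}) => σ j) G := by
    intro σ hσ τ hτ heq
    funext j
    by_cases hj : j ∈ J
    · rw [hagree σ hσ j hj, hagree τ hτ j hj]
    · exact congrFun heq ⟨j, hj⟩
  have hcard : #G ≤ 2 ^ (Fintype.card ι - #J) := by
    refine (card_le_card_of_injOn _ (fun σ _ => mem_univ _) hinj).trans (le_of_eq ?_)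
    rw [card_univ, Fintype.card_fun, Fintype.card_bool, Fintype.card_subtype_compl,
      Fintype.card_coe]
  calc #G * 2 ^ m ≤ 2 ^ (Fintype.card ι - #J) * 2 ^ #J := by gcongr; norm_num
    _ = 2 ^ Fintype.card ι := by rw [← pow_add, Nat.sub_add_cancel (card_le_univ J)]

/-- The member of a pair selected by a Boolean. -/
def pick {X : Type*} (p : X × X) (b : Bool) : X := if b then p.2 else p.1

/-- Exchange the members of the pairs `j` with `σ j = true`. -/
def swapPairs {X ι : Type*} (σ : ι → Bool) (z : ι → X × X) : ι → X × X :=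
  fun j => (pick (z j) (σ j), pick (z j) (!σ j))

open Classical in
/-- The double samples `(x, x')` on which some member of the class contains no point of `x` and at
least `m` points of `x'`. -/
def splitEvent {X Z ι : Type*} [Fintype ι] (Θ₀ : Set Z) (A : Z → Set X) (m : ℕ) :
    Set (ι → X × X) :=
  {z | ∃ θ ∈ Θ₀, (∀ j, (z j).1 ∉ A θ) ∧ m ≤ #{j | (z j).2 ∈ A θ}}

open Classical in
theorem card_swapPairs_mem_splitEvent_mul_le {X Z ι : Type*} [Fintype ι] {Θ₀ : Set Z}
    {A : Z → Set X} {d : ℕ} (h : VCBounded Θ₀ A d) (m : ℕ) {t : ℝ} (ht0 : 0 < t)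
    (ht1 : t ≤ 1) (z : ι → X × X) :
    (#{σ : ι → Bool | swapPairs σ z ∈ splitEvent Θ₀ A m} : ℝ) ≤
      2 ^ Fintype.card ι * ((t ^ d)⁻¹ * Real.exp (2 * t * Fintype.card ι) * (2 ^ m)⁻¹) := by
  set 𝒜 := traces Θ₀ A (fun k : ι × Bool => pick (z k.1) k.2) with h𝒜
  have hsub : ({σ : ι → Bool | swapPairs σ z ∈ splitEvent Θ₀ A m} : Finset _) ⊆
      𝒜.biUnion fun a => {σ : ι → Bool | (∀ j, (j, σ j) ∉ a) ∧ m ≤ #{j | (j, !σ j) ∈ a}} := by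
    intro σ hσ
    obtain ⟨θ, hθ, h1, h2⟩ := (mem_filter.1 hσ).2
    refine mem_biUnion.2 ⟨univ.filter fun k => pick (z k.1) k.2 ∈ A θ, ?_, ?_⟩
    · exact mem_filter.2 ⟨mem_univ _, θ, hθ, fun k => by simp only [mem_filter_univ]⟩
    · simpa using ⟨h1, h2⟩
  have hnat : #{σ : ι → Bool | swapPairs σ z ∈ splitEvent Θ₀ A m} * 2 ^ m ≤
      #𝒜 * 2 ^ Fintype.card ι := by
    refine (Nat.mul_le_mul_right _ ((card_le_card hsub).trans card_biUnion_le)).trans ?_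
    rw [sum_mul, ← smul_eq_mul, ← sum_const]
    exact sum_le_sum fun a _ => card_splittings_mul_two_pow_le a m
  have hreal : (#{σ : ι → Bool | swapPairs σ z ∈ splitEvent Θ₀ A m} : ℝ) * 2 ^ m ≤
      #𝒜 * 2 ^ Fintype.card ι := by exact_mod_cast hnat
  have hS := card_mul_pow_le_exp (vcDim_traces_le h fun k : ι × Bool => pick (z k.1) k.2)
    ht0.le ht1
  rw [Fintype.card_prod, Fintype.card_bool] at hS
  have hS' : (#𝒜 : ℝ) ≤ (t ^ d)⁻¹ * Real.exp (2 * t * Fintype.card ι) := by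
    rw [inv_mul_eq_div, le_div_iff₀ (pow_pos ht0 d)]
    refine hS.trans (le_of_eq ?_)
    push_cast
    ring_nf
  rw [← mul_assoc, ← div_eq_mul_inv, le_div_iff₀ (by positivity)]
  refine hreal.trans ?_
  rw [mul_comm]
  gcongr

end Combinatorics

/-! ### The `ε`-net theorem -/

section EpsilonNet

variable {X Z : Type*} [MeasurableSpace X] [MeasurableSpace Z] {ι : Type*} [Fintype ι]

theorem measurableSet_section {A : Z → Set X} (hA : MeasurableSet {p : Z × X | p.2 ∈ A p.1})
    (θ : Z) : MeasurableSet (A θ) :=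
  measurable_prodMk_left (x := θ) hA

theorem measurePreserving_swapPairs (Q : Measure X) [IsProbabilityMeasure Q] (σ : ι → Bool) :
    MeasurePreserving (swapPairs σ) (Measure.pi fun _ : ι => Q.prod Q)
      (Measure.pi fun _ : ι => Q.prod Q) := by
  refine measurePreserving_pi (f := fun j p => (pick p (σ j), pick p (!σ j))) _ _ fun j => ?_
  cases σ j
  · exact MeasurePreserving.id _
  · exact Measure.measurePreserving_swap

theorem nullMeasurableSet_splitEvent [StandardBorelSpace Z] (ρ : Measure (ι → X × X))
    [IsFiniteMeasure ρ] {Θ₀ : Set Z} (hΘ : MeasurableSet Θ₀) {A : Z → Set X}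
    (hA : MeasurableSet {p : Z × X | p.2 ∈ A p.1}) (m : ℕ) :
    NullMeasurableSet (splitEvent Θ₀ A m) ρ := by
  classical
  have h1 : ∀ j, MeasurableSet {p : Z × (ι → X × X) | (p.2 j).1 ∈ A p.1} := fun j =>
    (measurable_fst.prodMk ((measurable_pi_apply j).comp measurable_snd).fst) hA
  have h2 : ∀ j, MeasurableSet {p : Z × (ι → X × X) | (p.2 j).2 ∈ A p.1} := fun j =>
    (measurable_fst.prodMk ((measurable_pi_apply j).comp measurable_snd).snd) hA
  have h3 : MeasurableSet {p : Z × (ι → X × X) | m ≤ Finset.card {j | (p.2 j).2 ∈ A p.1}} := by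
    simp_rw [Finset.card_filter]
    exact measurableSet_le measurable_const
      (Finset.measurable_sum _ fun j _ => Measurable.ite (h2 j) measurable_const measurable_const)
  have h4 : MeasurableSet {p : Z × (ι → X × X) | ∀ j, (p.2 j).1 ∉ A p.1} := by
    rw [Set.ofPred_forall]
    exact MeasurableSet.iInter fun j => (h1 j).compl
  have hE : MeasurableSet {p : Z × (ι → X × X) | p.1 ∈ Θ₀ ∧ (∀ j, (p.2 j).1 ∉ A p.1) ∧
      m ≤ Finset.card {j | (p.2 j).2 ∈ A p.1}} :=
    (measurable_fst hΘ).inter (h4.inter h3)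
  exact nullMeasurableSet_exists_of_measurableSet ρ hE

/-- Symmetrization: exchanging the members of the pairs does not change the law of the double
sample, and for each double sample few of the exchanges lead into the event. -/
theorem measure_splitEvent_le [StandardBorelSpace Z] (Q : Measure X) [IsProbabilityMeasure Q]
    {Θ₀ : Set Z} (hΘ : MeasurableSet Θ₀) {A : Z → Set X}
    (hA : MeasurableSet {p : Z × X | p.2 ∈ A p.1}) {d : ℕ} (hd : VCBounded Θ₀ A d) (m : ℕ)
    {t : ℝ} (ht0 : 0 < t) (ht1 : t ≤ 1) :
    (Measure.pi fun _ : ι => Q.prod Q) (splitEvent Θ₀ A m) ≤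
      ENNReal.ofReal ((t ^ d)⁻¹ * Real.exp (2 * t * Fintype.card ι) * (2 ^ m)⁻¹) := by
  classical
  set ρ := Measure.pi fun _ : ι => Q.prod Q
  set V := splitEvent (ι := ι) Θ₀ A m
  set c := (t ^ d)⁻¹ * Real.exp (2 * t * Fintype.card ι) * (2 ^ m)⁻¹
  have hV : NullMeasurableSet V ρ := nullMeasurableSet_splitEvent ρ hΘ hA m
  have hmp := fun σ : ι → Bool => measurePreserving_swapPairs Q σ
  have hVσ : ∀ σ : ι → Bool, NullMeasurableSet (swapPairs σ ⁻¹' V) ρ := fun σ =>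
    hV.preimage (hmp σ).quasiMeasurePreserving
  have hsum : (2 : ℝ≥0∞) ^ Fintype.card ι * ρ V = ∑ σ : ι → Bool, ρ (swapPairs σ ⁻¹' V) := by
    rw [Finset.sum_congr rfl fun σ _ => (hmp σ).measure_preimage hV, Finset.sum_const,
      Finset.card_univ, Fintype.card_fun, Fintype.card_bool, nsmul_eq_mul]
    push_cast
    rfl
  have hle : ∑ σ : ι → Bool, ρ (swapPairs σ ⁻¹' V) ≤
      ENNReal.ofReal (2 ^ Fintype.card ι * c) := by
    calc ∑ σ : ι → Bool, ρ (swapPairs σ ⁻¹' V)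
        = ∑ σ : ι → Bool, ∫⁻ z, (swapPairs σ ⁻¹' V).indicator 1 z ∂ρ :=
          Finset.sum_congr rfl fun σ _ => (lintegral_indicator_one₀ (hVσ σ)).symm
      _ = ∫⁻ z, ∑ σ : ι → Bool, (swapPairs σ ⁻¹' V).indicator 1 z ∂ρ :=
          (lintegral_finsetSum' _ fun σ _ =>
            (aemeasurable_const (b := (1 : ℝ≥0∞))).indicator₀ (hVσ σ)).symm
      _ ≤ ∫⁻ _, ENNReal.ofReal (2 ^ Fintype.card ι * c) ∂ρ := by
          refine lintegral_mono fun z => ?_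
          have := card_swapPairs_mem_splitEvent_mul_le hd m ht0 ht1 z
          rw [ENNReal.le_ofReal_iff_toReal_le (by simp [Set.indicator_apply]) (by positivity)]
          · simpa [Set.indicator_apply, Finset.sum_boole, V] using this
      _ = ENNReal.ofReal (2 ^ Fintype.card ι * c) := by simp
  rw [← hsum, ENNReal.ofReal_mul (by positivity), ENNReal.ofReal_pow (by norm_num),
    ENNReal.ofReal_ofNat] at hle
  exact (ENNReal.mul_le_mul_iff_right (by positivity) (by finiteness)).1 hle

open Classical in
/-- Lower tail of a binomial law, by Markov's inequality for `2 ^ (-count)`. -/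
theorem measure_card_lt_le_half (Q : Measure X) [IsProbabilityMeasure Q] {A : Set X}
    (hA : MeasurableSet A) {η : ℝ} (hη : ENNReal.ofReal η ≤ Q A)
    (h5 : 5 ≤ η * Fintype.card ι) :
    (Measure.pi fun _ : ι => Q) {x | (Finset.card {j | x j ∈ A} : ℝ) < η * Fintype.card ι / 2} ≤
      2⁻¹ := by
  set n := Fintype.card ι
  set ρ := Measure.pi fun _ : ι => Q
  let g : X → ℝ := fun x => if x ∈ A then 2⁻¹ else 1
  have hg : Measurable g := Measurable.ite hA measurable_const measurable_const
  have hg1 : ∀ x, ‖g x‖ ≤ 1 := fun x => by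
    simp only [g]; split_ifs <;> norm_num
  have hprod : ∀ x : ι → X, ∏ j, g (x j) = (2⁻¹ : ℝ) ^ Finset.card {j | x j ∈ A} := fun x => by
    simp only [g]
    rw [Finset.prod_ite]
    simp
  have hint : ∫ x, g x ∂Q = 1 - Q.real A / 2 := by
    have : g = fun x => 1 - A.indicator (fun _ => (2⁻¹ : ℝ)) x := by
      funext x
      simp only [g, Set.indicator_apply]
      split_ifs <;> norm_num
    rw [this, integral_sub (integrable_const _) ((integrable_const _).indicator hA),
      integral_indicator_const _ hA]
    simp
    ring
  have hηQ : η ≤ Q.real A := by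
    rw [measureReal_def]
    exact (ENNReal.ofReal_le_iff_le_toReal (measure_ne_top _ _)).1 hη
  have hI : ∫ x, ∏ j, g (x j) ∂ρ ≤ Real.exp (-(η * n / 2)) := by
    rw [integral_fintype_prod_eq_pow, hint]
    calc (1 - Q.real A / 2) ^ n ≤ Real.exp (-(η / 2)) ^ n := by
          gcongr
          · linarith [measureReal_le_one (μ := Q) (s := A)]
          · linarith [Real.one_sub_le_exp_neg (η / 2)]
      _ = Real.exp (-(η * n / 2)) := by rw [← Real.exp_nat_mul]; ring_nf
  have hmark := mul_meas_ge_le_integral_of_nonneg (μ := ρ)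
    (f := fun x => ∏ j, g (x j))
    (Filter.Eventually.of_forall fun x => by simp only [hprod]; positivity)
    (by
      refine Integrable.of_bound (C := 1) (Measurable.aestronglyMeasurable ?_) ?_
      · exact Finset.measurable_prod _ fun j _ => hg.comp (measurable_pi_apply j)
      · refine Filter.Eventually.of_forall fun x => ?_
        rw [norm_prod]
        exact Finset.prod_le_one (fun _ _ => norm_nonneg _) fun j _ => hg1 _)
    (Real.exp (-(Real.log 2 * (η * n / 2))))
  set u := η * n / 2 with hu
  have hsub : {x : ι → X | (Finset.card {j | x j ∈ A} : ℝ) < u} ⊆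
      {x | Real.exp (-(Real.log 2 * u)) ≤ ∏ j, g (x j)} := by
    intro x hx
    simp only [Set.mem_ofPred_eq] at hx ⊢
    rw [hprod, ← Real.exp_log (show (0 : ℝ) < 2⁻¹ by norm_num), ← Real.exp_nat_mul, Real.log_inv]
    refine Real.exp_le_exp.2 ?_
    nlinarith [Real.log_pos one_lt_two]
  have h6 : ρ.real {x | Real.exp (-(Real.log 2 * u)) ≤ ∏ j, g (x j)} ≤ 2⁻¹ := by
    have h7 : ρ.real {x | Real.exp (-(Real.log 2 * u)) ≤ ∏ j, g (x j)} ≤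
        Real.exp (-(Real.log 2)) := by
      have h8 := hmark.trans hI
      rw [mul_comm, ← le_div_iff₀ (Real.exp_pos _), ← Real.exp_sub] at h8
      refine h8.trans (Real.exp_le_exp.2 ?_)
      nlinarith [Real.log_two_lt_d9, Real.log_two_gt_d9]
    refine h7.trans (le_of_eq ?_)
    rw [Real.exp_neg, Real.exp_log two_pos]
  refine (measure_mono hsub).trans ?_
  rw [measureReal_def] at h6
  refine (ENNReal.le_ofReal_iff_toReal_le (measure_ne_top _ _) (by norm_num)).2 h6 |>.trans ?_
  rw [ENNReal.ofReal_inv_of_pos two_pos, ENNReal.ofReal_ofNat]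

/-- The event that a sample misses a member of the class of measure larger than `η`. -/
def missEvent (ι : Type*) (Q : Measure X) (Θ₀ : Set Z) (A : Z → Set X) (η : ℝ) : Set (ι → X) :=
  {x | ∃ θ ∈ Θ₀, ENNReal.ofReal η < Q (A θ) ∧ ∀ j, x j ∉ A θ}

/-- Ghost sample: given that the first sample misses a set of measure larger than `η`, the second
hits that set at least `η n / 2` times with probability `1 / 2` or more. -/
theorem measure_missEvent_le_two_mul (Q : Measure X) [IsProbabilityMeasure Q] {Θ₀ : Set Z}
    {A : Z → Set X} (hA : MeasurableSet {p : Z × X | p.2 ∈ A p.1}) {η : ℝ}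
    (h5 : 5 ≤ η * Fintype.card ι) :
    (Measure.pi fun _ : ι => Q) (missEvent ι Q Θ₀ A η) ≤
      2 * (Measure.pi fun _ : ι => Q.prod Q)
        (splitEvent Θ₀ A ⌈η * Fintype.card ι / 2⌉₊) := by
  classical
  set ρ := Measure.pi fun _ : ι => Q
  set n := Fintype.card ι
  set e := MeasurableEquiv.arrowProdEquivProdArrow X X ι
  have he := measurePreserving_arrowProdEquivProdArrow X X ι (fun _ => Q) (fun _ => Q)
  set V := splitEvent (ι := ι) Θ₀ A ⌈η * n / 2⌉₊
  set M := toMeasurable (ρ.prod ρ) (e.symm ⁻¹' V)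
  have hM : MeasurableSet M := measurableSet_toMeasurable _ _
  have hMV : (ρ.prod ρ) M = (Measure.pi fun _ : ι => Q.prod Q) V := by
    rw [measure_toMeasurable, ← he.measure_preimage_equiv]
    rfl
  have hhalf : missEvent ι Q Θ₀ A η ⊆ {x | 2⁻¹ ≤ ρ (Prod.mk x ⁻¹' M)} := by
    rintro x ⟨θ, hθ, hQ, hx⟩
    have hAθ := measurableSet_section hA θ
    have hbad := measure_card_lt_le_half (ι := ι) Q hAθ hQ.le h5
    have hsub : {y : ι → X | (Finset.card {j | y j ∈ A θ} : ℝ) < η * n / 2}ᶜ ⊆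
        Prod.mk x ⁻¹' M := by
      intro y hy
      refine subset_toMeasurable _ _ ?_
      refine ⟨θ, hθ, hx, ?_⟩
      exact Nat.ceil_le.2 (not_lt.1 hy)
    refine le_trans ?_ (measure_mono hsub)
    have hms : MeasurableSet {y : ι → X | (Finset.card {j | y j ∈ A θ} : ℝ) < η * n / 2} := by
      simp_rw [Finset.card_filter]
      push_cast
      refine measurableSet_lt (Finset.measurable_sum _ fun j _ => ?_) measurable_const
      exact Measurable.ite (measurable_pi_apply j hAθ) measurable_const measurable_const
    rw [prob_compl_eq_one_sub hms]
    refine le_trans (le_of_eq ?_) (tsub_le_tsub_left hbad 1)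
    exact ENNReal.one_sub_inv_two.symm
  have hmark := mul_meas_ge_le_lintegral (μ := ρ) (measurable_measure_prodMk_left (ν := ρ) hM) 2⁻¹
  rw [← Measure.prod_apply hM, hMV] at hmark
  calc ρ (missEvent ι Q Θ₀ A η) ≤ ρ {x | 2⁻¹ ≤ ρ (Prod.mk x ⁻¹' M)} := measure_mono hhalf
    _ = 2 * (2⁻¹ * ρ {x | 2⁻¹ ≤ ρ (Prod.mk x ⁻¹' M)}) := by
        rw [← mul_assoc, ENNReal.mul_inv_cancel two_ne_zero ENNReal.ofNat_ne_top, one_mul]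
    _ ≤ _ := by gcongr

/-- The `ε`-net theorem: a sample of size of order `η⁻¹ (d log η⁻¹ + log δ⁻¹)` meets, with
probability at least `1 - δ`, every member of a class of Vapnik–Chervonenkis dimension `d` whose
measure is larger than `η`. -/
theorem measure_missEvent_le [StandardBorelSpace Z] (Q : Measure X) [IsProbabilityMeasure Q]
    {Θ₀ : Set Z} (hΘ : MeasurableSet Θ₀) {A : Z → Set X}
    (hA : MeasurableSet {p : Z × X | p.2 ∈ A p.1}) {d : ℕ} (hd : VCBounded Θ₀ A d) (hd1 : 1 ≤ d)
    {η δ : ℝ} (hη : 0 < η) (hη1 : η ≤ 1) (hδ : 0 < δ) (hδ1 : δ ≤ 1)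
    (hn : 5 * (d * Real.log (16 / η) + Real.log (2 / δ)) ≤ η * Fintype.card ι) :
    (Measure.pi fun _ : ι => Q) (missEvent ι Q Θ₀ A η) ≤ ENNReal.ofReal δ := by
  set n := Fintype.card ι
  have hd1' : (1 : ℝ) ≤ d := by exact_mod_cast hd1
  have hlog16 : 1 ≤ Real.log (16 / η) := by
    rw [Real.le_log_iff_exp_le (by positivity), le_div_iff₀ hη]
    nlinarith [Real.exp_one_lt_d9]
  have hlogδ : 0 ≤ Real.log (2 / δ) := Real.log_nonneg (by rw [le_div_iff₀ hδ]; linarith)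
  have h5 : 5 ≤ η * n := by nlinarith
  refine (measure_missEvent_le_two_mul Q hA h5).trans ?_
  refine (mul_le_mul_right (measure_splitEvent_le Q hΘ hA hd _ (t := η / 16) (by positivity)
    (by linarith)) 2).trans ?_
  rw [← ENNReal.ofReal_ofNat 2, ← ENNReal.ofReal_mul (by norm_num)]
  refine ENNReal.ofReal_le_ofReal ?_
  have h2 : ((2 : ℝ) ^ ⌈η * n / 2⌉₊)⁻¹ ≤ Real.exp (-(Real.log 2 * (η * n / 2))) := by
    rw [Real.exp_neg]
    refine inv_anti₀ (Real.exp_pos _) ?_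
    have h3 : (2 : ℝ) ^ ⌈η * n / 2⌉₊ = Real.exp (⌈η * n / 2⌉₊ * Real.log 2) := by
      rw [Real.exp_nat_mul, Real.exp_log two_pos]
    rw [h3]
    refine Real.exp_le_exp.2 ?_
    nlinarith [Real.log_pos one_lt_two, Nat.le_ceil (η * n / 2)]
  have ht : ((η / 16) ^ d)⁻¹ = Real.exp (d * Real.log (16 / η)) := by
    rw [Real.exp_nat_mul, Real.exp_log (by positivity), ← inv_pow, inv_div]
  have hδ2 : δ = 2 * Real.exp (-Real.log (2 / δ)) := by
    rw [Real.exp_neg, Real.exp_log (by positivity), inv_div]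
    ring
  calc 2 * (((η / 16) ^ d)⁻¹ * Real.exp (2 * (η / 16) * n) * (2 ^ ⌈η * n / 2⌉₊)⁻¹)
      ≤ 2 * (Real.exp (d * Real.log (16 / η)) * Real.exp (2 * (η / 16) * n) *
          Real.exp (-(Real.log 2 * (η * n / 2)))) := by rw [ht]; gcongr
    _ = 2 * Real.exp (d * Real.log (16 / η) + 2 * (η / 16) * n - Real.log 2 * (η * n / 2)) := by
        rw [← Real.exp_add, ← Real.exp_add]; ring_nf
    _ ≤ 2 * Real.exp (-Real.log (2 / δ)) := by
        gcongr
        nlinarith [Real.log_two_gt_d9]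
    _ = δ := hδ2.symm

end EpsilonNet

/-! ### Samples from a region that depends on the history -/

section ConditionalSampling

variable {Ω H X Z ι : Type*} [MeasurableSpace Ω] [MeasurableSpace H] [MeasurableSpace X]
  [MeasurableSpace Z] [Fintype ι]

/-- The `ι`-fold power of a Markov kernel: independent samples given the parameter. -/
noncomputable def powKernel (ι : Type*) [Fintype ι] (Q : Kernel H X) [IsMarkovKernel Q] :
    Kernel H (ι → X) where
  toFun h := Measure.pi fun _ : ι => Q h
  measurable' := by
    refine Measurable.measure_of_isPiSystem_of_isProbabilityMeasure generateFrom_pi.symm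
      isPiSystem_pi ?_
    rintro s ⟨t, ht, rfl⟩
    simp_rw [Measure.pi_pi]
    exact Finset.measurable_prod _ fun j _ => Q.measurable_coe (ht j (Set.mem_univ j))

theorem powKernel_apply (Q : Kernel H X) [IsMarkovKernel Q] (h : H) :
    powKernel ι Q h = Measure.pi fun _ : ι => Q h := rfl

instance (Q : Kernel H X) [IsMarkovKernel Q] : IsMarkovKernel (powKernel ι Q) :=
  ⟨fun h => by rw [powKernel_apply]; infer_instance⟩

open Classical in
/-- The law `P` conditioned on the section of `M` at `h`; it is `P` itself where this section is
null and there is nothing to condition on. -/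
noncomputable def condKernel (P : Measure X) [IsProbabilityMeasure P] {M : Set (H × X)}
    (hM : MeasurableSet M) : Kernel H X where
  toFun h := if P (Prod.mk h ⁻¹' M) = 0 then P else P[|Prod.mk h ⁻¹' M]
  measurable' := by
    have hp : Measurable fun h => P (Prod.mk h ⁻¹' M) := measurable_measure_prodMk_left hM
    refine Measurable.ite (hp (measurableSet_singleton 0)) measurable_const ?_
    refine Measure.measurable_of_measurable_coe _ fun s hs => ?_
    simp_rw [fun h : H => cond_apply (measurable_prodMk_left (x := h) hM) P s]
    exact hp.inv.mul (measurable_measure_prodMk_left (hM.inter (measurable_snd hs)))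

theorem condKernel_apply_of_ne_zero (P : Measure X) [IsProbabilityMeasure P] {M : Set (H × X)}
    (hM : MeasurableSet M) {h : H} (h0 : P (Prod.mk h ⁻¹' M) ≠ 0) :
    condKernel P hM h = P[|Prod.mk h ⁻¹' M] :=
  if_neg h0

instance (P : Measure X) [IsProbabilityMeasure P] {M : Set (H × X)} (hM : MeasurableSet M) :
    IsMarkovKernel (condKernel P hM) := by
  refine ⟨fun h => ?_⟩
  by_cases h0 : P (Prod.mk h ⁻¹' M) = 0
  · rw [show condKernel P hM h = P from if_pos h0]
    infer_instance
  · rw [condKernel_apply_of_ne_zero P hM h0]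
    exact cond_isProbabilityMeasure h0

theorem cond_congr_set {P : Measure X} {s t : Set X} (h : s =ᵐ[P] t) : P[|s] = P[|t] := by
  rw [ProbabilityTheory.cond, ProbabilityTheory.cond, measure_congr h, Measure.restrict_congr_set h]

/-- On a set of histories on which a kernel gives the conditional probabilities of `Y`, the joint
law of the history and `Y` is the composition-product with that kernel. -/
theorem map_restrict_eq_compProd {Y' : Type*} [MeasurableSpace Y'] (μ : Measure Ω)
    [IsProbabilityMeasure μ] {hist : Ω → H} (hhist : Measurable hist) {Y : Ω → Y'}
    (hY : Measurable Y) {G : Set H} (hG : MeasurableSet G) (κ : Kernel H Y') [IsMarkovKernel κ]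
    (hκ : ∀ E : Set Y', MeasurableSet E → ∀ᵐ ω ∂μ, hist ω ∈ G →
      (μ⟦Y ⁻¹' E | MeasurableSpace.comap hist inferInstance⟧) ω = (κ (hist ω)).real E) :
    (μ.restrict (hist ⁻¹' G)).map (fun ω => (hist ω, Y ω)) =
      ((μ.map hist).restrict G).compProd κ := by
  have : IsFiniteMeasure ((μ.restrict (hist ⁻¹' G)).map (fun ω => (hist ω, Y ω))) :=
    Measure.isFiniteMeasure_map _ _
  refine Measure.ext_prod fun {s E} hs hE => ?_
  have hsG : MeasurableSet (hist ⁻¹' (s ∩ G)) := hhist (hs.inter hG)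
  rw [Measure.compProd_apply_prod hs hE, Measure.restrict_restrict hs,
    setLIntegral_map (hs.inter hG) (κ.measurable_coe hE) hhist,
    Measure.map_apply (hhist.prodMk hY) (hs.prod hE),
    Measure.restrict_apply ((hhist.prodMk hY) (hs.prod hE))]
  have hset : (fun ω => (hist ω, Y ω)) ⁻¹' s ×ˢ E ∩ hist ⁻¹' G =
      Y ⁻¹' E ∩ hist ⁻¹' (s ∩ G) := by
    ext ω
    simp only [Set.mem_inter_iff, Set.mem_preimage, Set.mem_prod]
    tauto
  have hint : ∫ ω in hist ⁻¹' (s ∩ G), (κ (hist ω)).real E ∂μ =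
      μ.real (Y ⁻¹' E ∩ hist ⁻¹' (s ∩ G)) := by
    calc ∫ ω in hist ⁻¹' (s ∩ G), (κ (hist ω)).real E ∂μ
        = ∫ ω in hist ⁻¹' (s ∩ G),
            (μ⟦Y ⁻¹' E | MeasurableSpace.comap hist inferInstance⟧) ω ∂μ :=
          setIntegral_congr_ae hsG ((hκ E hE).mono fun ω hω hω' => (hω hω'.2).symm)
      _ = ∫ ω in hist ⁻¹' (s ∩ G), (Y ⁻¹' E).indicator (fun _ => (1 : ℝ)) ω ∂μ :=
          setIntegral_condExp hhist.comap_le ((integrable_const _).indicator (hY hE))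
            ⟨s ∩ G, hs.inter hG, rfl⟩
      _ = μ.real (Y ⁻¹' E ∩ hist ⁻¹' (s ∩ G)) := by
          rw [integral_indicator_const _ (hY hE), measureReal_restrict_apply (hY hE)]
          simp
  have hlint : ∫⁻ ω in hist ⁻¹' (s ∩ G), κ (hist ω) E ∂μ =
      ENNReal.ofReal (∫ ω in hist ⁻¹' (s ∩ G), (κ (hist ω)).real E ∂μ) := by
    rw [ofReal_integral_eq_lintegral_ofReal]
    · exact lintegral_congr fun ω => by simp
    · refine Integrable.of_bound (C := 1)
        ((κ.measurable_coe hE).comp hhist).ennreal_toReal.aestronglyMeasurable ?_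
      refine Filter.Eventually.of_forall fun ω => ?_
      rw [Real.norm_of_nonneg measureReal_nonneg]
      exact measureReal_le_one
    · exact Filter.Eventually.of_forall fun ω => measureReal_nonneg
  rw [hset, hlint, hint, ofReal_measureReal]

/-- A null-measurable set all of whose sections have measure at most `c` has measure at most
`c`. -/
theorem compProd_le_of_section_le {Y' : Type*} [MeasurableSpace Y'] (ν : Measure H)
    [IsFiniteMeasure ν] (hν : ν Set.univ ≤ 1) (κ : Kernel H Y') [IsMarkovKernel κ]
    {V : Set (H × Y')} (hV : NullMeasurableSet V (ν.compProd κ)) {c : ℝ≥0∞}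
    (hc : ∀ h, κ h (Prod.mk h ⁻¹' V) ≤ c) : (ν.compProd κ) V ≤ c := by
  have hM := measurableSet_toMeasurable (ν.compProd κ) V
  have hae := Measure.ae_ae_of_ae_compProd hV.toMeasurable_ae_eq
  rw [← measure_toMeasurable, Measure.compProd_apply hM]
  calc ∫⁻ h, κ h (Prod.mk h ⁻¹' toMeasurable (ν.compProd κ) V) ∂ν
      ≤ ∫⁻ _, c ∂ν := by
        refine lintegral_mono_ae (hae.mono fun h hh => ?_)
        exact (measure_congr (μ := κ h)
          (s := Prod.mk h ⁻¹' toMeasurable (ν.compProd κ) V) hh).trans_le (hc h)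
    _ ≤ c := by
        rw [lintegral_const]
        exact mul_le_of_le_one_right zero_le hν

theorem nullMeasurableSet_missEvent [StandardBorelSpace Z] (Q : Kernel H X) [IsMarkovKernel Q]
    (R : Measure (H × (ι → X))) [IsFiniteMeasure R] {Θ₀ : Set Z} (hΘ : MeasurableSet Θ₀)
    {A : Z → Set X} (hA : MeasurableSet {p : Z × X | p.2 ∈ A p.1}) (η : ℝ) :
    NullMeasurableSet {p : H × (ι → X) | p.2 ∈ missEvent ι (Q p.1) Θ₀ A η} R := by
  have h1 : MeasurableSet {p : Z × H × (ι → X) | ENNReal.ofReal η < Q p.2.1 (A p.1)} := by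
    have hA' : MeasurableSet {q : (Z × H) × X | q.2 ∈ A q.1.1} :=
      (measurable_fst.fst.prodMk measurable_snd) hA
    have := Kernel.measurable_kernel_prodMk_left (κ := Q.comap Prod.snd measurable_snd) hA'
    exact measurableSet_lt measurable_const
      (this.comp (measurable_fst.prodMk measurable_snd.fst))
  have h2 : MeasurableSet {p : Z × H × (ι → X) | ∀ j, p.2.2 j ∉ A p.1} := by
    have h3 : ∀ j, Measurable fun p : Z × H × (ι → X) => (p.1, p.2.2 j) := fun j =>
      measurable_fst.prodMk ((measurable_pi_apply j).comp measurable_snd.snd)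
    rw [Set.ofPred_forall]
    exact MeasurableSet.iInter fun j => (h3 j hA).compl
  exact nullMeasurableSet_exists_of_measurableSet R ((measurable_fst hΘ).inter (h1.inter h2))

/-- A bound on the probability of the miss event, uniform in the sampling law, passes to samples
drawn from `P` conditioned on a random region `D (hist ω)`. Only the probability of fixed events is
prescribed by the sampling hypothesis; null-measurability of the graph of `D` turns it into a
statement about the joint law of the history and the sample. -/
theorem measure_missEvent_cond_le [StandardBorelSpace Z] (μ : Measure Ω) [IsProbabilityMeasure μ]
    (P : Measure X) [IsProbabilityMeasure P] {hist : Ω → H} (hhist : Measurable hist)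
    {Y : Ω → ι → X} (hY : Measurable Y) {D : H → Set X}
    (hD : NullMeasurableSet {p : H × X | p.2 ∈ D p.1} ((μ.map hist).prod P))
    (hlaw : ∀ E : Set (ι → X), MeasurableSet E → ∀ᵐ ω ∂μ, P (D (hist ω)) ≠ 0 →
      (μ⟦Y ⁻¹' E | MeasurableSpace.comap hist inferInstance⟧) ω =
        (Measure.pi fun _ : ι => P[|D (hist ω)]).real E)
    {Θ₀ : Set Z} (hΘ : MeasurableSet Θ₀) {A : Z → Set X}
    (hA : MeasurableSet {p : Z × X | p.2 ∈ A p.1}) {η : ℝ} {c : ℝ≥0∞}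
    (hc : ∀ (Q : Measure X) [IsProbabilityMeasure Q],
      (Measure.pi fun _ : ι => Q) (missEvent ι Q Θ₀ A η) ≤ c) :
    μ {ω | P (D (hist ω)) ≠ 0 ∧ Y ω ∈ missEvent ι (P[|D (hist ω)]) Θ₀ A η} ≤ c := by
  set ν := μ.map hist
  have : IsProbabilityMeasure ν := Measure.isProbabilityMeasure_map hhist.aemeasurable
  set M := toMeasurable (ν.prod P) {p : H × X | p.2 ∈ D p.1}
  have hM : MeasurableSet M := measurableSet_toMeasurable _ _
  have hDM : ∀ᵐ ω ∂μ, Prod.mk (hist ω) ⁻¹' M =ᵐ[P] D (hist ω) :=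
    ae_of_ae_map hhist.aemeasurable (Measure.ae_ae_of_ae_prod hD.toMeasurable_ae_eq)
  set Q := condKernel P hM
  set G : Set H := {h | P (Prod.mk h ⁻¹' M) ≠ 0}
  have hG : MeasurableSet G :=
    (measurable_measure_prodMk_left hM (measurableSet_singleton 0)).compl
  have hQ : ∀ᵐ ω ∂μ, (hist ω ∈ G ↔ P (D (hist ω)) ≠ 0) ∧
      (hist ω ∈ G → Q (hist ω) = P[|D (hist ω)]) := by
    filter_upwards [hDM] with ω hω
    have hiff : hist ω ∈ G ↔ P (D (hist ω)) ≠ 0 := by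
      rw [← measure_congr hω]
      exact Iff.rfl
    exact ⟨hiff, fun h => (condKernel_apply_of_ne_zero P hM h).trans (cond_congr_set hω)⟩
  have hjoint := map_restrict_eq_compProd μ hhist hY hG (powKernel ι Q) fun E hE => by
    filter_upwards [hlaw E hE, hQ] with ω h1 h2 hω
    rw [h1 (h2.1.1 hω), powKernel_apply, h2.2 hω]
  set V : Set (H × (ι → X)) := {p | p.2 ∈ missEvent ι (Q p.1) Θ₀ A η}
  have hV : ((ν.restrict G).compProd (powKernel ι Q)) V ≤ c :=
    compProd_le_of_section_le _ (by simpa using prob_le_one) _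
      (nullMeasurableSet_missEvent Q _ hΘ hA η) fun h => hc (Q h)
  rw [← hjoint] at hV
  refine le_trans ?_ ((Measure.le_map_apply (hhist.prodMk hY).aemeasurable V).trans hV)
  refine le_trans ?_ (Measure.le_restrict_apply _ _)
  refine measure_mono_ae ?_
  filter_upwards [hQ] with ω hω hbad
  have hωG : hist ω ∈ G := hω.1.2 hbad.1
  refine ⟨?_, hωG⟩
  show Y ω ∈ missEvent ι (Q (hist ω)) Θ₀ A η
  rw [hω.2 hωG]
  exact hbad.2

end ConditionalSampling

/-! ### Error sets, version spaces and regions of disagreement -/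

section Errors

variable {S A : Type*} {T k : ℕ} {r : Param k → S → A → ℝ} {θH : Param k}

/-- The pairs on which `r_θ` strictly reverses the true label. -/
def errSet (r : Param k → S → A → ℝ) (θH θ : Param k) : Set (TrajPair S A T) :=
  {x | prefFun r θ (x, trueLabel r θH x) < 0}

theorem mem_errSet_iff {θ : Param k} {x : TrajPair S A T} :
    x ∈ errSet r θH θ ↔
      (cumReward r θH x.1 ≤ cumReward r θH x.2 ∧ cumReward r θ x.2 < cumReward r θ x.1) ∨
      (cumReward r θH x.2 < cumReward r θH x.1 ∧ cumReward r θ x.1 < cumReward r θ x.2) := by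
  by_cases h : cumReward r θH x.1 ≤ cumReward r θH x.2
  · simp only [errSet, prefFun, trueLabel, h, if_true, Set.mem_ofPred_eq, true_and, not_lt.2 h,
      false_and, or_false]
    norm_num
  · simp only [errSet, prefFun, trueLabel, h, if_false, Set.mem_ofPred_eq, false_and, not_le.1 h,
      true_and, false_or]
    norm_num

theorem notMem_errSet_self (x : TrajPair S A T) : x ∉ errSet r θH θH := by
  rw [mem_errSet_iff]
  rintro (⟨h1, h2⟩ | ⟨h1, h2⟩) <;> linarith

theorem classifier_eq_one_iff {θ : Param k} {x : TrajPair S A T} :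
    classifier r θ x = 1 ↔ cumReward r θ x.1 < cumReward r θ x.2 := by
  unfold classifier
  split_ifs with h <;> simp [h]

theorem fin_two_eq_iff {a b : Fin 2} : a = b ↔ (a = 1 ↔ b = 1) := by
  revert a b
  decide

open Classical in
/-- The pair with its members exchanged if the human weakly prefers the second. -/
noncomputable def humanOrder (r : Param k → S → A → ℝ) (θH : Param k) (x : TrajPair S A T) :
    TrajPair S A T :=
  if cumReward r θH x.1 ≤ cumReward r θH x.2 then x.swap else x

/-- The strict reversals of `r_θ` are seen by its classifier after reordering the pair. -/
theorem mem_errSet_iff_classifier {θ : Param k} {x : TrajPair S A T} :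
    x ∈ errSet r θH θ ↔ classifier r θ (humanOrder r θH x) = 1 := by
  rw [mem_errSet_iff, classifier_eq_one_iff, humanOrder]
  split_ifs with h
  · simp [h, not_lt.2 h]
  · simp [h, not_le.1 h]

/-- The error sets form a class of dimension at most that of the classifiers. Up to null sets each
of them is the disagreement set of a classifier with the human one, but the null set depends on the
parameter; the pull-back along `humanOrder` gives the bound without exceptional sets. -/
theorem vcBounded_errSet {Θ₀ : Set (Param k)} {d : ℕ} (h : vcDim (classifiers T r Θ₀) ≤ d) :
    VCBounded Θ₀ (errSet (T := T) r θH) d := by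
  classical
  intro s hs
  have hinj : Set.InjOn (humanOrder r θH) (s : Set (TrajPair S A T)) := by
    intro x hx y hy hxy
    obtain ⟨θ, -, hθ⟩ := hs {x} (Finset.singleton_subset_iff.2 hx)
    have h1 : x ∈ errSet r θH θ := (hθ x hx).2 (Finset.mem_singleton_self x)
    rw [mem_errSet_iff_classifier, hxy, ← mem_errSet_iff_classifier, hθ y hy] at h1
    exact (Finset.mem_singleton.1 h1).symm
  have hsh : Shatters (classifiers T r Θ₀) (s.image (humanOrder r θH)) := by
    intro b
    obtain ⟨θ, hθ0, hθ⟩ := hs (s.filter fun x => b (humanOrder r θH x) = 1)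
      (Finset.filter_subset _ _)
    refine ⟨classifier r θ, ⟨θ, hθ0, rfl⟩, fun y hy => ?_⟩
    obtain ⟨x, hx, rfl⟩ := Finset.mem_image.1 hy
    rw [fin_two_eq_iff, ← mem_errSet_iff_classifier, hθ x hx]
    simp [hx]
  rw [← Finset.card_image_of_injOn hinj]
  exact_mod_cast (le_iSup₂ (f := fun (s : Finset (TrajPair S A T))
    (_ : Shatters (classifiers T r Θ₀) s) => (s.card : ℕ∞)) _ hsh).trans h

theorem errSet_eq_empty_of_vcBounded_zero {Θ₀ : Set (Param k)} (hθH : θH ∈ Θ₀)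
    (h : VCBounded Θ₀ (errSet (T := T) r θH) 0) {θ : Param k} (hθ : θ ∈ Θ₀) :
    errSet (T := T) r θH θ = ∅ := by
  classical
  refine Set.eq_empty_of_forall_notMem fun x hx => ?_
  have := h {x} fun t ht => ?_
  · simp at this
  · rcases Finset.subset_singleton_iff.1 ht with rfl | rfl
    · exact ⟨θH, hθH, fun y _ => by simp [notMem_errSet_self y]⟩
    · exact ⟨θ, hθ, fun y hy => by rw [Finset.mem_singleton.1 hy]; simpa using hx⟩

variable [MeasurableSpace S] [MeasurableSpace A]

theorem measurable_cumReward
    (hr : Measurable fun p : Param k × S × A => r p.1 p.2.1 p.2.2) :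
    Measurable fun p : Param k × Trajectory S A T => cumReward r p.1 p.2 := by
  unfold cumReward
  refine Finset.measurable_sum _ fun t _ => ?_
  have h : Measurable fun p : Param k × Trajectory S A T => (p.1, p.2.1 t.castSucc, p.2.2 t) :=
    measurable_fst.prodMk (((measurable_pi_apply t.castSucc).comp measurable_snd.fst).prodMk
      ((measurable_pi_apply t).comp measurable_snd.snd))
  exact hr.comp h

theorem measurable_cumReward_fst
    (hr : Measurable fun p : Param k × S × A => r p.1 p.2.1 p.2.2) :
    Measurable fun p : Param k × TrajPair S A T => cumReward r p.1 p.2.1 :=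
  (measurable_cumReward hr).comp (measurable_fst.prodMk measurable_snd.fst)

theorem measurable_cumReward_snd
    (hr : Measurable fun p : Param k × S × A => r p.1 p.2.1 p.2.2) :
    Measurable fun p : Param k × TrajPair S A T => cumReward r p.1 p.2.2 :=
  (measurable_cumReward hr).comp (measurable_fst.prodMk measurable_snd.snd)

theorem measurable_classifier
    (hr : Measurable fun p : Param k × S × A => r p.1 p.2.1 p.2.2) :
    Measurable fun p : Param k × TrajPair S A T => classifier r p.1 p.2 := by
  unfold classifier
  exact Measurable.ite (measurableSet_lt (measurable_cumReward_fst hr)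
    (measurable_cumReward_snd hr)) measurable_const measurable_const

theorem measurable_prefFun
    (hr : Measurable fun p : Param k × S × A => r p.1 p.2.1 p.2.2) :
    Measurable fun p : Param k × Preference S A T => prefFun r p.1 p.2 := by
  unfold prefFun
  have hy : Measurable fun p : Param k × Preference S A T => ((p.2.2 : ℕ) : ℝ) :=
    (measurable_of_finite fun y : Fin 2 => ((y : ℕ) : ℝ)).comp measurable_snd.snd
  have hx : Measurable fun p : Param k × Preference S A T => (p.1, p.2.1) :=
    measurable_fst.prodMk measurable_snd.fst
  exact (measurable_const.sub (hy.const_mul 2)).mul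
    (((measurable_cumReward_fst hr).comp hx).sub ((measurable_cumReward_snd hr).comp hx))

theorem measurableSet_errSet
    (hr : Measurable fun p : Param k × S × A => r p.1 p.2.1 p.2.2) (θH : Param k) :
    MeasurableSet {p : Param k × TrajPair S A T | p.2 ∈ errSet r θH p.1} := by
  have hH : Measurable fun p : Param k × TrajPair S A T => (θH, p.2) :=
    measurable_const.prodMk measurable_snd
  have hl : Measurable fun p : Param k × TrajPair S A T => trueLabel r θH p.2 := by
    unfold trueLabel
    exact Measurable.ite (measurableSet_le ((measurable_cumReward_fst hr).comp hH)
      ((measurable_cumReward_snd hr).comp hH)) measurable_const measurable_const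
  exact measurableSet_lt ((measurable_prefFun hr).comp
    (measurable_fst.prodMk (measurable_snd.prodMk hl))) measurable_const

/-- Two parameters with the same ties up to null sets: outside the ties a strict reversal is the
same as a disagreement of the classifiers. -/
theorem errSet_ae_eq {P : Measure (TrajPair S A T)} {θ : Param k}
    (htie : ∀ᵐ x ∂P, (cumReward r θ x.1 = cumReward r θ x.2 ↔
      cumReward r θH x.1 = cumReward r θH x.2)) :
    errSet r θH θ =ᵐ[P] {x | classifier r θH x ≠ classifier r θ x} := by
  filter_upwards [htie] with x hx
  refine propext ?_
  change x ∈ errSet r θH θ ↔ classifier r θH x ≠ classifier r θ x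
  rw [mem_errSet_iff, Ne, fin_two_eq_iff, classifier_eq_one_iff, classifier_eq_one_iff]
  grind

end Errors

section VersionSpaces

variable {S A : Type*} {T k N : ℕ} {r : Param k → S → A → ℝ} {θH : Param k} {Θ₀ : Set (Param k)}

theorem hypSpace_eq_inter (B : ℕ → Fin N → Preference S A T) (i : ℕ) :
    hypSpace r Θ₀ B i = Θ₀ ∩ {θ | ∀ n : Fin i, θ ∈ batchCut r (B n)} := by
  induction i with
  | zero => simp [hypSpace]
  | succ i ih =>
    ext θ
    simp only [hypSpace, ih, Set.mem_inter_iff, Set.mem_ofPred_eq, Fin.forall_fin_succ',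
      Fin.val_castSucc, Fin.val_last, and_assoc]

theorem hypSpace_subset (B : ℕ → Fin N → Preference S A T) (i : ℕ) :
    hypSpace r Θ₀ B i ⊆ Θ₀ := by
  rw [hypSpace_eq_inter]
  exact Set.inter_subset_left

/-- The human parameter survives every batch of true labels. -/
theorem mem_hypSpace_of_true_labels (hθH : θH ∈ Θ₀) {B : ℕ → Fin N → Preference S A T} {I : ℕ}
    (hB : ∀ i < I, ∀ j, (B i j).2 = trueLabel r θH (B i j).1) {i : ℕ} (hi : i ≤ I) :
    θH ∈ hypSpace r Θ₀ B i := by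
  rw [hypSpace_eq_inter]
  refine ⟨hθH, fun n j => ?_⟩
  have h := notMem_errSet_self (r := r) (θH := θH) (B n j).1
  rw [errSet, Set.mem_ofPred_eq, ← hB n (n.2.trans_le hi) j, not_lt] at h
  exact h

variable [MeasurableSpace S] [MeasurableSpace A]

theorem measurableSet_mem_hypSpace
    (hr : Measurable fun p : Param k × S × A => r p.1 p.2.1 p.2.2) (hΘ : MeasurableSet Θ₀)
    (i : ℕ) :
    MeasurableSet {p : Param k × (Fin i → Fin N → Preference S A T) |
      p.1 ∈ Θ₀ ∩ {θ | ∀ n : Fin i, θ ∈ batchCut r (p.2 n)}} := by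
  have hm : ∀ (n : Fin i) (j : Fin N),
      Measurable fun p : Param k × (Fin i → Fin N → Preference S A T) => (p.1, p.2 n j) :=
    fun n j => by fun_prop
  have h : ∀ (n : Fin i) (j : Fin N),
      MeasurableSet {p : Param k × (Fin i → Fin N → Preference S A T) |
        0 ≤ prefFun r p.1 (p.2 n j)} := by
    intro n j
    have hp := (measurable_prefFun hr).comp (hm n j)
    exact measurableSet_le measurable_const hp
  convert (measurable_fst hΘ).inter
    (MeasurableSet.iInter fun n => MeasurableSet.iInter (h n)) using 1
  ext p
  simp [batchCut]

theorem nullMeasurableSet_disRegion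
    (hr : Measurable fun p : Param k × S × A => r p.1 p.2.1 p.2.2) (hΘ : MeasurableSet Θ₀)
    (i : ℕ) (R : Measure ((Fin i → Fin N → Preference S A T) × TrajPair S A T))
    [IsFiniteMeasure R] :
    NullMeasurableSet {p : (Fin i → Fin N → Preference S A T) × TrajPair S A T |
      p.2 ∈ disRegion (classifiers T r (Θ₀ ∩ {θ | ∀ n : Fin i, θ ∈ batchCut r (p.1 n)}))} R := by
  have hm1 : Measurable fun q : (Param k × Param k) ×
      (Fin i → Fin N → Preference S A T) × TrajPair S A T => (q.1.1, q.2.1) :=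
    measurable_fst.fst.prodMk measurable_snd.fst
  have hm2 : Measurable fun q : (Param k × Param k) ×
      (Fin i → Fin N → Preference S A T) × TrajPair S A T => (q.1.2, q.2.1) :=
    measurable_fst.snd.prodMk measurable_snd.fst
  have hc1 : Measurable fun q : (Param k × Param k) ×
      (Fin i → Fin N → Preference S A T) × TrajPair S A T => classifier r q.1.1 q.2.2 :=
    (measurable_classifier hr).comp (measurable_fst.fst.prodMk measurable_snd.snd)
  have hc2 : Measurable fun q : (Param k × Param k) ×
      (Fin i → Fin N → Preference S A T) × TrajPair S A T => classifier r q.1.2 q.2.2 :=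
    (measurable_classifier hr).comp (measurable_fst.snd.prodMk measurable_snd.snd)
  have hE := ((hm1 (measurableSet_mem_hypSpace hr hΘ i)).inter
    (hm2 (measurableSet_mem_hypSpace hr hΘ i))).inter (measurableSet_eq_fun hc1 hc2).compl
  convert nullMeasurableSet_exists_of_measurableSet R hE using 1
  ext ⟨h, x⟩
  constructor
  · rintro ⟨-, ⟨θ₁, h1, rfl⟩, -, ⟨θ₂, h2, rfl⟩, hne⟩
    exact ⟨(θ₁, θ₂), ⟨h1, h2⟩, hne⟩
  · rintro ⟨⟨θ₁, θ₂⟩, ⟨h1, h2⟩, hne⟩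
    exact ⟨_, ⟨θ₁, h1, rfl⟩, _, ⟨θ₂, h2, rfl⟩, hne⟩

/-- A batch of true labels is unlikely to be consistent with a parameter of large error on the
current region of disagreement. -/
theorem measure_bad_batch_le (hr : Measurable fun p : Param k × S × A => r p.1 p.2.1 p.2.2)
    (hΘ : MeasurableSet Θ₀) (P : Measure (TrajPair S A T)) [IsProbabilityMeasure P]
    {d : ℕ} (hd : vcDim (classifiers T r Θ₀) ≤ d) (hd1 : 1 ≤ d)
    {Ω : Type*} [MeasurableSpace Ω] (μ : Measure Ω) [IsProbabilityMeasure μ] {I : ℕ}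
    {B : ℕ → Ω → Fin N → Preference S A T} (hB : IsDisagreementQuery r Θ₀ P I μ B) {i : ℕ}
    (hi : i < I) {η δ : ℝ} (hη : 0 < η) (hη1 : η ≤ 1) (hδ : 0 < δ) (hδ1 : δ ≤ 1)
    (hN : 5 * (d * Real.log (16 / η) + Real.log (2 / δ)) ≤ η * N) :
    μ {ω | P (disRegion (classifiers T r (hypSpace r Θ₀ (fun n => B n ω) i))) ≠ 0 ∧
        (fun j => (B i ω j).1) ∈ missEvent (Fin N)
          (P[|disRegion (classifiers T r (hypSpace r Θ₀ (fun n => B n ω) i))]) Θ₀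
          (errSet r θH) η} ≤ ENNReal.ofReal δ := by
  have hhist : Measurable fun ω (n : Fin i) => B n ω :=
    measurable_pi_lambda _ fun n => hB.measurable n
  have hY : Measurable fun ω j => (B i ω j).1 :=
    measurable_pi_lambda _ fun j => ((measurable_pi_apply j).comp (hB.measurable i)).fst
  have hlaw := hB.condLaw i hi
  simp_rw [hypSpace_eq_inter] at hlaw ⊢
  have : IsProbabilityMeasure (μ.map fun ω (n : Fin i) => B n ω) :=
    Measure.isProbabilityMeasure_map hhist.aemeasurable
  exact measure_missEvent_cond_le μ P hhist hY
    (D := fun h => disRegion (classifiers T r (Θ₀ ∩ {θ | ∀ n : Fin i, θ ∈ batchCut r (h n)})))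
    (nullMeasurableSet_disRegion hr hΘ i _) hlaw hΘ (measurableSet_errSet hr θH) fun Q _ =>
      measure_missEvent_le Q hΘ (measurableSet_errSet hr θH) (vcBounded_errSet hd) hd1 hη hη1 hδ
        hδ1 (by rwa [Fintype.card_fin])

theorem measure_errSet_eq_inter_disRegion {P : Measure (TrajPair S A T)} {Θ : Set (Param k)}
    {θ : Param k} (hθH : θH ∈ Θ) (hθ : θ ∈ Θ)
    (htie : ∀ᵐ x ∂P, (cumReward r θ x.1 = cumReward r θ x.2 ↔
      cumReward r θH x.1 = cumReward r θH x.2)) :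
    P (errSet r θH θ) = P (errSet r θH θ ∩ disRegion (classifiers T r Θ)) := by
  have h := errSet_ae_eq htie
  rw [measure_congr h, measure_congr (h.inter (ae_eq_refl (disRegion (classifiers T r Θ))))]
  rw [Set.inter_eq_left.2]
  exact fun x hx => ⟨_, ⟨θH, hθH, rfl⟩, _, ⟨θ, hθ, rfl⟩, hx⟩

/-- The disagreement coefficient turns a small error of all surviving classifiers, relative to the
region of disagreement, into a region of disagreement of half the measure. -/
theorem measure_disRegion_le_half (hr : Measurable fun p : Param k × S × A => r p.1 p.2.1 p.2.2)
    {P : Measure (TrajPair S A T)} [IsProbabilityMeasure P]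
    (htie : ∀ θ ∈ Θ₀, ∀ᵐ x ∂P, (cumReward r θ x.1 = cumReward r θ x.2 ↔
      cumReward r θH x.1 = cumReward r θH x.2))
    {ζ : ℝ≥0} (hζ : disCoeff P (classifiers T r Θ₀) (classifier r θH) = ζ) {η : ℝ} (hη : 0 < η)
    (hηζ : ζ * η ≤ 2⁻¹) {Θ Θ' : Set (Param k)} (hΘ : Θ ⊆ Θ₀) (hΘ' : Θ' ⊆ Θ) (hθH : θH ∈ Θ)
    (herr : P (disRegion (classifiers T r Θ)) ≠ 0 → ∀ θ ∈ Θ',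
      P[|disRegion (classifiers T r Θ)] (errSet r θH θ) ≤ ENNReal.ofReal η) :
    P (disRegion (classifiers T r Θ')) ≤ 2⁻¹ * P (disRegion (classifiers T r Θ)) := by
  set D := disRegion (classifiers T r Θ)
  by_cases h0 : P D = 0
  · have hsub : disRegion (classifiers T r Θ') ⊆ D := by
      rintro x ⟨h₁, hh₁, h₂, hh₂, hne⟩
      exact ⟨h₁, Set.image_mono hΘ' hh₁, h₂, Set.image_mono hΘ' hh₂, hne⟩
    rw [measure_mono_null hsub h0]
    exact zero_le
  have hD : 0 < P.real D := (ENNReal.toReal_pos h0 (measure_ne_top P D))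
  set ρ := η * P.real D
  have hρ : 0 < ρ := by positivity
  have hball : classifiers T r Θ' ⊆ classBall P (classifiers T r Θ₀) (classifier r θH) ρ := by
    rintro _ ⟨θ, hθ, rfl⟩
    have hθΘ := hΘ' hθ
    refine ⟨⟨θ, hΘ hθΘ, rfl⟩, ?_⟩
    have hm : MeasurableSet (errSet (T := T) r θH θ) :=
      measurableSet_section (measurableSet_errSet hr θH) θ
    have hcond := herr h0 θ hθ
    rw [ProbabilityTheory.cond, Measure.smul_apply, Measure.restrict_apply hm, smul_eq_mul,
      ENNReal.inv_mul_le_iff h0 (measure_ne_top _ _)] at hcond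
    rw [← measure_congr (errSet_ae_eq (htie θ (hΘ hθΘ))),
      measure_errSet_eq_inter_disRegion hθH hθΘ (htie θ (hΘ hθΘ))]
    refine hcond.trans (le_of_eq ?_)
    rw [ENNReal.ofReal_mul hη.le, ofReal_measureReal, mul_comm]
  have hcoef : P (disRegion (classBall P (classifiers T r Θ₀) (classifier r θH) ρ)) ≤
      ζ * ENNReal.ofReal ρ := by
    rw [← ENNReal.div_le_iff (by simpa using hρ) ENNReal.ofReal_ne_top, ← hζ]
    exact le_iSup₂ (f := fun (ρ : ℝ) (_ : 0 < ρ) =>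
      P (disRegion (classBall P (classifiers T r Θ₀) (classifier r θH) ρ)) / ENNReal.ofReal ρ) ρ hρ
  have hsub : disRegion (classifiers T r Θ') ⊆
      disRegion (classBall P (classifiers T r Θ₀) (classifier r θH) ρ) := by
    rintro x ⟨h₁, hh₁, h₂, hh₂, hne⟩
    exact ⟨h₁, hball hh₁, h₂, hball hh₂, hne⟩
  refine (measure_mono hsub).trans (hcoef.trans ?_)
  rw [ENNReal.ofReal_mul hη.le, ofReal_measureReal, ← mul_assoc]
  gcongr
  rw [← ENNReal.ofReal_coe_nnreal, ← ENNReal.ofReal_mul (NNReal.coe_nonneg ζ),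
    ← ENNReal.ofReal_ofNat 2,
    ← ENNReal.ofReal_inv_of_pos two_pos]
  exact ENNReal.ofReal_le_ofReal hηζ

/-- If no batch misses a parameter of large error, the region of disagreement halves with each
batch. -/
theorem measure_disRegion_hypSpace_le
    (hr : Measurable fun p : Param k × S × A => r p.1 p.2.1 p.2.2)
    {P : Measure (TrajPair S A T)} [IsProbabilityMeasure P] (hθH : θH ∈ Θ₀)
    (htie : ∀ θ ∈ Θ₀, ∀ᵐ x ∂P, (cumReward r θ x.1 = cumReward r θ x.2 ↔
      cumReward r θH x.1 = cumReward r θH x.2))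
    {ζ : ℝ≥0} (hζ : disCoeff P (classifiers T r Θ₀) (classifier r θH) = ζ) {η : ℝ} (hη : 0 < η)
    (hηζ : ζ * η ≤ 2⁻¹) {B : ℕ → Fin N → Preference S A T} {I : ℕ}
    (hB : ∀ i < I, ∀ j, (B i j).2 = trueLabel r θH (B i j).1)
    (hgood : ∀ i < I, P (disRegion (classifiers T r (hypSpace r Θ₀ B i))) ≠ 0 →
      (fun j => (B i j).1) ∉ missEvent (Fin N)
        (P[|disRegion (classifiers T r (hypSpace r Θ₀ B i))]) Θ₀ (errSet r θH) η)
    {i : ℕ} (hi : i ≤ I) :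
    P (disRegion (classifiers T r (hypSpace r Θ₀ B i))) ≤ 2⁻¹ ^ i := by
  induction i with
  | zero => simpa using prob_le_one
  | succ i ih =>
    have hiI : i < I := hi
    rw [pow_succ']
    refine le_trans ?_ (mul_le_mul_right (ih hiI.le) _)
    refine measure_disRegion_le_half hr htie hζ hη hηζ (hypSpace_subset B i)
      Set.inter_subset_left (mem_hypSpace_of_true_labels hθH hB hiI.le) fun h0 θ hθ => ?_
    by_contra hlt
    refine hgood i hiI h0 ⟨θ, hypSpace_subset B (i + 1) hθ, not_le.1 hlt, fun j hj => ?_⟩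
    have hcut := hθ.2 j
    rw [errSet, Set.mem_ofPred_eq, ← hB i hiI j] at hj
    exact absurd hcut (not_le.2 hj)

end VersionSpaces

/-! ### Number of queries -/

section Budget

/-- The total number of queries, for `⌈2 L⌉` batches of the size that the `ε`-net theorem asks for
at `η = 1 / (2 Z)` and failure probability `δ / ⌈2 L⌉`. -/
theorem batchSize_mul_le {Z L δ : ℝ} (hZ : 2 ≤ Z) (hL : 1 ≤ L) (hδ : 0 < δ) (hδ1 : δ < 1) {d : ℕ}
    (hd : 1 ≤ d) :
    (⌈10 * Z * (d * Real.log (32 * Z) + Real.log (2 * ⌈2 * L⌉₊ / δ))⌉₊ : ℝ) * (⌈2 * L⌉₊ : ℝ) ≤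
      273 * (Z * (d * Real.log Z + Real.log (L / δ)) * L) := by
  have hd1 : (1 : ℝ) ≤ d := by exact_mod_cast hd
  have hI : (⌈2 * L⌉₊ : ℝ) ≤ 3 * L := by
    linarith [(Nat.ceil_lt_add_one (show 0 ≤ 2 * L by linarith)).le]
  have hI1 : (1 : ℝ) ≤ ⌈2 * L⌉₊ := by linarith [Nat.le_ceil (2 * L)]
  have hlog2 := Real.log_two_gt_d9
  have hlogZ : Real.log 2 ≤ Real.log Z := Real.log_le_log two_pos hZ
  have hlog32 : Real.log (32 * Z) ≤ 6 * Real.log Z := by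
    rw [Real.log_mul (by norm_num) (by linarith), show (32 : ℝ) = 2 ^ 5 by norm_num, Real.log_pow]
    push_cast
    linarith
  have hlogδ : Real.log (2 * ⌈2 * L⌉₊ / δ) ≤ 3 * Real.log Z + Real.log (L / δ) := by
    have h8 : 3 * Real.log 2 = Real.log 8 := by
      rw [show (8 : ℝ) = 2 ^ 3 by norm_num, Real.log_pow]
      norm_num
    calc Real.log (2 * ⌈2 * L⌉₊ / δ) ≤ Real.log (8 * (L / δ)) := by
          refine Real.log_le_log (by positivity) ?_
          rw [← mul_div_assoc]
          exact div_le_div_of_nonneg_right (by linarith) hδ.le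
      _ = Real.log 8 + Real.log (L / δ) := Real.log_mul (by norm_num) (by positivity)
      _ ≤ _ := by linarith
  have hLδ : 0 ≤ Real.log (L / δ) := Real.log_nonneg (by rw [le_div_iff₀ hδ]; linarith)
  set a := Real.log Z
  set b := Real.log (L / δ)
  have hda : a ≤ d * a := by nlinarith
  have hdlog : (d : ℝ) * Real.log (32 * Z) ≤ 6 * (d * a) := by nlinarith
  have hN0 : 0 ≤ 10 * Z * (d * Real.log (32 * Z) + Real.log (2 * ⌈2 * L⌉₊ / δ)) := by
    have h1 : 0 ≤ Real.log (32 * Z) := Real.log_nonneg (by linarith)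
    have h2 : 0 ≤ Real.log (2 * ⌈2 * L⌉₊ / δ) :=
      Real.log_nonneg (by rw [le_div_iff₀ hδ]; linarith)
    positivity
  have hN : (⌈10 * Z * (d * Real.log (32 * Z) + Real.log (2 * ⌈2 * L⌉₊ / δ))⌉₊ : ℝ) ≤
      91 * (Z * (d * a + b)) := by
    refine (Nat.ceil_lt_add_one hN0).le.trans ?_
    have h1 : Z * (d * Real.log (32 * Z) + Real.log (2 * ⌈2 * L⌉₊ / δ)) ≤
        Z * (9 * (d * a) + b) := by
      refine mul_le_mul_of_nonneg_left ?_ (by linarith)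
      linarith
    -- `Z * d * log Z ≥ 2 * log 2 ≥ 1` absorbs the rounding.
    have h2 : 1 ≤ Z * (d * a) := by nlinarith
    have h3 : 0 ≤ Z * b := mul_nonneg (by linarith) hLδ
    nlinarith
  calc _ ≤ 91 * (Z * (d * a + b)) * (3 * L) := by gcongr; nlinarith
    _ = 273 * (Z * (d * a + b) * L) := by ring

theorem two_inv_pow_ceil_le {ε : ℝ} (hε : 0 < ε) :
    (2⁻¹ : ℝ≥0∞) ^ ⌈2 * max (Real.log (1 / ε)) 1⌉₊ ≤ ENNReal.ofReal ε := by
  set I := ⌈2 * max (Real.log (1 / ε)) 1⌉₊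
  have h : (2⁻¹ : ℝ) ^ I ≤ ε := by
    rw [← Real.log_le_log_iff (by positivity) hε, Real.log_pow, Real.log_inv]
    have h1 : 2 * max (Real.log (1 / ε)) 1 ≤ I := Nat.le_ceil _
    have h2 := le_max_left (Real.log (1 / ε)) 1
    have h3 := le_max_right (Real.log (1 / ε)) 1
    rw [one_div, Real.log_inv] at h1 h2 h3
    nlinarith [Real.log_two_gt_d9]
  refine le_trans (le_of_eq ?_) (ENNReal.ofReal_le_ofReal h)
  rw [ENNReal.ofReal_pow (by norm_num), ENNReal.ofReal_inv_of_pos two_pos, ENNReal.ofReal_ofNat]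

end Budget

end HSBC

theorem mainTheorem1 :
    ∃ C : ℝ, 0 < C ∧
      ∀ (ζ : ℝ≥0) (d : ℕ) (ε δ : ℝ), 0 < ε → 0 < δ → δ < 1 →
        ∃ N I : ℕ,
          (N : ℝ) * (I : ℝ) ≤
            C * (max (ζ : ℝ) 2 *
              (d * Real.log (max (ζ : ℝ) 2) +
                Real.log (max (Real.log (1 / ε)) 1 / δ)) *
              max (Real.log (1 / ε)) 1) ∧
          ∀ (S : Type*) (A : Type*) [MeasurableSpace S] [MeasurableSpace A] (T k : ℕ)
            (r : HSBC.Param k → S → A → ℝ)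
            (_ : Measurable fun p : HSBC.Param k × S × A => r p.1 p.2.1 p.2.2)
            (Θ₀ : Set (HSBC.Param k)) (_ : MeasurableSet Θ₀)
            (θH : HSBC.Param k) (_ : θH ∈ Θ₀)
            (P : Measure (HSBC.TrajPair S A T)) [IsProbabilityMeasure P]
            (_ : ∀ θ ∈ Θ₀, ∀ᵐ x ∂P,
              (HSBC.cumReward r θ x.1 = HSBC.cumReward r θ x.2 ↔
                HSBC.cumReward r θH x.1 = HSBC.cumReward r θH x.2))
            (_ : HSBC.vcDim (HSBC.classifiers T r Θ₀) = d)
            (_ : HSBC.disCoeff P (HSBC.classifiers T r Θ₀) (HSBC.classifier r θH) = ζ)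
            (Ω : Type*) [MeasurableSpace Ω] (μ : Measure Ω) [IsProbabilityMeasure μ]
            (B : ℕ → Ω → Fin N → HSBC.Preference S A T)
            (_ : HSBC.IsDisagreementQuery r Θ₀ P I μ B)
            (_ : ∀ i < I, ∀ ω j, (B i ω j).2 = HSBC.trueLabel r θH (B i ω j).1),
            μ {ω | ¬ ∀ θ ∈ HSBC.hypSpace r Θ₀ (fun i => B i ω) I,
                HSBC.predError r θH P θ ≤ ENNReal.ofReal ε} ≤ ENNReal.ofReal δ := by
  refine ⟨273, by norm_num, fun ζ d ε δ hε hδ hδ1 => ?_⟩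
  set Z := max (ζ : ℝ) 2
  set L := max (Real.log (1 / ε)) 1
  have hZ : 2 ≤ Z := le_max_right _ _
  have hL : 1 ≤ L := le_max_right _ _
  have hLδ : 0 ≤ Real.log (L / δ) := Real.log_nonneg (by rw [le_div_iff₀ hδ]; linarith)
  rcases Nat.eq_zero_or_pos d with rfl | hd
  · -- A class of dimension `0` is a single classifier, and no query is needed.
    refine ⟨0, 0, by simp only [CharP.cast_eq_zero, zero_mul, zero_add]; positivity, ?_⟩
    intro S A _ _ T k r _ Θ₀ _ θH hθH P _ _ hvc _ Ω _ μ _ B _ _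
    refine le_of_eq_of_le ?_ zero_le
    convert measure_empty (μ := μ)
    refine Set.eq_empty_of_forall_notMem fun ω hω => hω fun θ hθ => ?_
    have hempty := HSBC.errSet_eq_empty_of_vcBounded_zero hθH
      (HSBC.vcBounded_errSet (θH := θH) hvc.le) hθ
    rw [HSBC.predError]
    change P (HSBC.errSet r θH θ) ≤ _
    rw [hempty, measure_empty]
    exact zero_le
  set I := ⌈2 * L⌉₊
  set N := ⌈10 * Z * (d * Real.log (32 * Z) + Real.log (2 * I / δ))⌉₊ with hNdef
  refine ⟨N, I, HSBC.batchSize_mul_le hZ hL hδ hδ1 hd, ?_⟩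
  intro S A _ _ T k r hr Θ₀ hΘ θH hθH P _ htie hvc hζ Ω _ μ _ B hB hlabel
  have hI1 : (1 : ℝ) ≤ I := by linarith [Nat.le_ceil (2 * L)]
  have hI0 : (0 : ℝ) < I := by linarith
  set η := (2 * Z)⁻¹ with hηdef
  have hη : 0 < η := by positivity
  have hη1 : η ≤ 1 := inv_le_one_of_one_le₀ (by linarith)
  have hηζ : ζ * η ≤ 2⁻¹ := by
    rw [hηdef, mul_inv, mul_left_comm]
    refine mul_le_of_le_one_right (by norm_num) ?_
    rw [← div_eq_mul_inv]
    exact div_le_one_of_le₀ (le_max_left _ _) (by linarith)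
  have hN : 5 * (d * Real.log (16 / η) + Real.log (2 / (δ / I))) ≤ η * N := by
    have h1 : 16 / η = 32 * Z := by rw [hηdef, div_inv_eq_mul]; ring
    have h2 : 2 / (δ / I) = 2 * I / δ := by field_simp
    rw [h1, h2, hηdef, inv_mul_eq_div, le_div_iff₀ (by positivity)]
    refine le_trans (le_of_eq ?_) (Nat.le_ceil _)
    ring
  have hbad := fun i (hi : i < I) => HSBC.measure_bad_batch_le (θH := θH) hr hΘ P hvc.le hd μ hB hi
    hη hη1 (div_pos hδ hI0) (div_le_one_of_le₀ (hδ1.le.trans hI1) hI0.le) hN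
  refine (measure_mono (t := ⋃ i ∈ Finset.range I, _) fun ω hω => ?_).trans
    ((measure_biUnion_finset_le (Finset.range I) _).trans
      ((Finset.sum_le_sum fun i hi => hbad i (Finset.mem_range.1 hi)).trans (le_of_eq ?_)))
  · by_contra hgood
    refine hω fun θ hθ => ?_
    have hgood' : ∀ i < I, P (HSBC.disRegion (HSBC.classifiers T r
        (HSBC.hypSpace r Θ₀ (fun n => B n ω) i))) ≠ 0 →
        (fun j => (B i ω j).1) ∉ HSBC.missEvent (Fin N) (P[|HSBC.disRegion (HSBC.classifiers T r
          (HSBC.hypSpace r Θ₀ (fun n => B n ω) i))]) Θ₀ (HSBC.errSet r θH) η :=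
      fun i hi h0 hmiss =>
        hgood (Set.mem_biUnion (Finset.mem_coe.2 (Finset.mem_range.2 hi)) ⟨h0, hmiss⟩)
    have hhalf := HSBC.measure_disRegion_hypSpace_le hr hθH htie hζ hη hηζ
      (fun i hi => hlabel i hi ω) hgood' le_rfl
    have hθ0 := HSBC.hypSpace_subset _ _ hθ
    refine le_trans ?_ (hhalf.trans (HSBC.two_inv_pow_ceil_le hε))
    refine (HSBC.measure_errSet_eq_inter_disRegion
      (HSBC.mem_hypSpace_of_true_labels hθH (fun i hi => hlabel i hi ω) le_rfl) hθ
      (htie θ hθ0)).trans_le ?_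
    exact measure_mono Set.inter_subset_right
  · rw [Finset.sum_const, Finset.card_range, nsmul_eq_mul, ← ENNReal.ofReal_natCast,
      ← ENNReal.ofReal_mul hI0.le, mul_div_cancel₀ _ hI0.ne']
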